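/- **Theorem (FPTAS for three-point distributions with the same right endpoint).** Let $X_1,\dots,X_n$ ($n\ge 1$) be independent random variables where, for each $i$, $X_i$ takes the values $a_i$, $m_i$, $1$ with probabilities $1-p_i-q_i$, $p_i$, $q_i$, for some reals with $a_i<m_i$, $m_i\in[0,1]$, $p_i,q_i\ge 0$ and $p_i+q_i\le 1$. For an ordering (permutation) $\sigma$ of $\{1,\dots,n\}$, the values $X_{\sigma(1)},X_{\sigma(2)},\dots,X_{\sigma(n)}$ are observed one after the other; after each observation a player either stops and receives the value just observed, or rejects it and continues; if no value is accepted the reward is $0$. Let $V_\sigma=\sup_\tau E[X_{\sigma(\tau)}]$ be the optimal expected reward, the supremum being over all stopping times $\tau\in\{1,\dots,n+1\}$ (whether $\tau=t$ depends only on the values observed in rounds $1,\dots,t$), with reward $0$ for $\tau=n+1$, and let $\mathrm{OPT}=\max_\sigma V_\sigma$. Then there is an algorithm which, given $n\ge 1$, $\varepsilon\in(0,1)$ and the parameters $(a_i,m_i,p_i,q_i)_{i\le n}$ of any such variables, outputs an ordering $\sigma$ with $$V_\sigma\ \ge\ (1-\varepsilon)\,\mathrm{OPT}$$ in time $O(n^5/\varepsilon^2)$.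 That is, there are a single program for a real RAM (unit-cost exact real arithmetic $+,-,\times,/$ and comparisons, and unit-cost index operations $+$, truncated $-$, halving, comparison and indirect addressing) and an absolute constant $C$ such that on every such input the program halts after at most $C\,n^5/\varepsilon^2$ elementary operations with such an ordering as its output. -/

import Mathlib

/-! ### Optimal stopping for independent three-point random variables -/

/-- The parameters of a random variable with values in `{a, m, 1}`: the value `a` has probability
`1 - p - q`, the value `m` has probability `p`, and the value `1` has probability `q`. -/
structure ThreePointVar where
  a : ℝ
  m : ℝ
  p : ℝ
  q : ℝ
  a_lt_m : a < m
  m_nonneg : 0 ≤ m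
  m_le_one : m ≤ 1
  p_nonneg : 0 ≤ p
  q_nonneg : 0 ≤ q
  p_add_q_le_one : p + q ≤ 1

namespace ThreePointVar

/-- The three support points. -/
def val (X : ThreePointVar) : Fin 3 → ℝ := ![X.a, X.m, 1]

/-- The probabilities of the three support points. -/
def prob (X : ThreePointVar) : Fin 3 → ℝ := ![1 - X.p - X.q, X.p, X.q]

end ThreePointVar

/-- A stopping time for a sequence of `n` observed real values. Rounds are numbered from `0`, and
the value `n` (that is, `Fin.last n`) means that no value is accepted. Whether to stop at round `t`
depends only on the values observed in the rounds up to and including `t`. -/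
structure StoppingTime (n : ℕ) where
  time : (Fin n → ℝ) → Fin (n + 1)
  adapted : ∀ (t : Fin n) (x y : Fin n → ℝ),
    (∀ s, s ≤ t → x s = y s) → time x = t.castSucc → time y = t.castSucc

/-- The accepted reward: the value observed at the stopping time, or `0` if none is accepted. -/
def StoppingTime.reward {n : ℕ} (τ : StoppingTime n) (x : Fin n → ℝ) : ℝ :=
  if h : (τ.time x : ℕ) < n then x ⟨τ.time x, h⟩ else 0

/-- The expected reward of a stopping time when independent variables `Y 0, …, Y (n - 1)` are
observed in this order; the expectation is taken over the finite product probability space. -/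
def expectedReward {n : ℕ} (Y : Fin n → ThreePointVar) (τ : StoppingTime n) : ℝ :=
  ∑ ω : Fin n → Fin 3, (∏ i, (Y i).prob (ω i)) * τ.reward (fun i => (Y i).val (ω i))

/-- The expected reward of optimal stopping, when `X (σ 0), X (σ 1), …` are observed in this
order. -/
noncomputable def orderingValue {n : ℕ} (X : Fin n → ThreePointVar) (σ : Equiv.Perm (Fin n)) : ℝ :=
  ⨆ τ : StoppingTime n, expectedReward (fun t => X (σ t)) τ

/-- The largest value of `orderingValue` over all orderings. -/
noncomputable def optimalOrderingValue {n : ℕ} (X : Fin n → ThreePointVar) : ℝ :=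
  ⨆ σ : Equiv.Perm (Fin n), orderingValue X σ

/-! ### A real RAM: structured programs over arrays of indices and arrays of reals, unit cost -/

namespace RealRAM

/-- The memory: arrays of natural numbers and arrays of real numbers. The first argument is the
name of the array and the second one the position in the array. A program mentions only finitely
many arrays. -/
structure State where
  idx : ℕ → ℕ → ℕ
  real : ℕ → ℕ → ℝ

/-- Write to one cell of an index array. -/
def State.setIdx (s : State) (A i v : ℕ) : State :=
  { s with idx := Function.update s.idx A (Function.update (s.idx A) i v) }

/-- Write to one cell of a real array. -/
def State.setReal (s : State) (A i : ℕ) (v : ℝ) : State :=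
  { s with real := Function.update s.real A (Function.update (s.real A) i v) }

/-- Index expressions: constants, array access (with computed addresses), addition, truncated
subtraction and halving. There is no multiplication of indices. -/
inductive IdxExpr where
  | lit (k : ℕ)
  | get (A : ℕ) (i : IdxExpr)
  | add (e f : IdxExpr)
  | sub (e f : IdxExpr)
  | half (e : IdxExpr)

/-- The value of an index expression; `half` rounds down. -/
def IdxExpr.eval (s : State) : IdxExpr → ℕ
  | lit k => k
  | get A i => s.idx A (i.eval s)
  | add e f => e.eval s + f.eval s
  | sub e f => e.eval s - f.eval s
  | half e => e.eval s / 2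

/-- The number of operations in an index expression. -/
def IdxExpr.cost : IdxExpr → ℕ
  | lit _ => 1
  | get _ i => i.cost + 1
  | add e f => e.cost + f.cost + 1
  | sub e f => e.cost + f.cost + 1
  | half e => e.cost + 1

/-- Real expressions: rational constants, array access and the four arithmetic operations. -/
inductive RealExpr where
  | lit (c : ℚ)
  | get (A : ℕ) (i : IdxExpr)
  | add (e f : RealExpr)
  | sub (e f : RealExpr)
  | mul (e f : RealExpr)
  | div (e f : RealExpr)

/-- The value of a real expression; a division by zero returns zero. -/
noncomputable def RealExpr.eval (s : State) : RealExpr → ℝ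
  | lit c => (c : ℝ)
  | get A i => s.real A (i.eval s)
  | add e f => e.eval s + f.eval s
  | sub e f => e.eval s - f.eval s
  | mul e f => e.eval s * f.eval s
  | div e f => e.eval s / f.eval s

/-- The number of operations in a real expression. -/
def RealExpr.cost : RealExpr → ℕ
  | lit _ => 1
  | get _ i => i.cost + 1
  | add e f => e.cost + f.cost + 1
  | sub e f => e.cost + f.cost + 1
  | mul e f => e.cost + f.cost + 1
  | div e f => e.cost + f.cost + 1

/-- Tests: comparisons of indices, comparisons of reals, and Boolean combinations. -/
inductive Test where
  | idxEq (e f : IdxExpr)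
  | idxLt (e f : IdxExpr)
  | realEq (e f : RealExpr)
  | realLt (e f : RealExpr)
  | neg (b : Test)
  | conj (b c : Test)

/-- The truth of a test. -/
def Test.Holds (s : State) : Test → Prop
  | idxEq e f => e.eval s = f.eval s
  | idxLt e f => e.eval s < f.eval s
  | realEq e f => e.eval s = f.eval s
  | realLt e f => e.eval s < f.eval s
  | neg b => ¬ b.Holds s
  | conj b c => b.Holds s ∧ c.Holds s

/-- The number of operations in a test. -/
def Test.cost : Test → ℕ
  | idxEq e f => e.cost + f.cost + 1
  | idxLt e f => e.cost + f.cost + 1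
  | realEq e f => e.cost + f.cost + 1
  | realLt e f => e.cost + f.cost + 1
  | neg b => b.cost + 1
  | conj b c => b.cost + c.cost + 1

/-- Programs: assignments to array cells, composition, branching and while-loops. -/
inductive Prog where
  | skip
  | setIdx (A : ℕ) (i : IdxExpr) (e : IdxExpr)
  | setReal (A : ℕ) (i : IdxExpr) (e : RealExpr)
  | seq (P Q : Prog)
  | ite (b : Test) (P Q : Prog)
  | loop (b : Test) (P : Prog)

/-- `Exec P s t s'`: the program `P`, started in the state `s`, halts in the state `s'` after
exactly `t` elementary operations. -/
inductive Exec : Prog → State → ℕ → State → Prop where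
  | skip (s : State) : Exec Prog.skip s 1 s
  | setIdx (A : ℕ) (i e : IdxExpr) (s : State) :
      Exec (Prog.setIdx A i e) s (i.cost + e.cost + 1) (s.setIdx A (i.eval s) (e.eval s))
  | setReal (A : ℕ) (i : IdxExpr) (e : RealExpr) (s : State) :
      Exec (Prog.setReal A i e) s (i.cost + e.cost + 1) (s.setReal A (i.eval s) (e.eval s))
  | seq {P Q : Prog} {s₁ s₂ s₃ : State} {t u : ℕ} :
      Exec P s₁ t s₂ → Exec Q s₂ u s₃ → Exec (Prog.seq P Q) s₁ (t + u) s₃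
  | iteTrue {b : Test} {P Q : Prog} {s s' : State} {t : ℕ} :
      b.Holds s → Exec P s t s' → Exec (Prog.ite b P Q) s (b.cost + t + 1) s'
  | iteFalse {b : Test} {P Q : Prog} {s s' : State} {t : ℕ} :
      ¬ b.Holds s → Exec Q s t s' → Exec (Prog.ite b P Q) s (b.cost + t + 1) s'
  | loopTrue {b : Test} {P : Prog} {s₁ s₂ s₃ : State} {t u : ℕ} :
      b.Holds s₁ → Exec P s₁ t s₂ → Exec (Prog.loop b P) s₂ u s₃ →
        Exec (Prog.loop b P) s₁ (b.cost + t + u + 1) s₃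
  | loopFalse {b : Test} {P : Prog} {s : State} :
      ¬ b.Holds s → Exec (Prog.loop b P) s (b.cost + 1) s

end RealRAM

/-- The initial memory: `n` is in cell `0` of index array `0`, `ε` is in cell `0` of real array `0`,
the parameters `a`, `m`, `p`, `q` of the variables are in the real arrays `1`, `2`, `3`, `4`, and
everything else is zero. -/
noncomputable def inputState {n : ℕ} (X : Fin n → ThreePointVar) (ε : ℝ) : RealRAM.State where
  idx A i := if A = 0 ∧ i = 0 then n else 0
  real A i :=
    if A = 0 ∧ i = 0 then ε
    else if h : i < n then
      if A = 1 then (X ⟨i, h⟩).a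
      else if A = 2 then (X ⟨i, h⟩).m
      else if A = 3 then (X ⟨i, h⟩).p
      else if A = 4 then (X ⟨i, h⟩).q
      else 0
    else 0

/-- The first `n` cells of index array `1` hold `σ 0, …, σ (n - 1)`. -/
def OutputsOrdering {n : ℕ} (s : RealRAM.State) (σ : Equiv.Perm (Fin n)) : Prop :=
  ∀ t : Fin n, s.idx 1 (t : ℕ) = (σ t : ℕ)

/-! By backward induction (`orderingValue_eq`) each round applies `v ↦ E[max(X, v)]` to a
continuation value `v` in `[0, 1]`. For a three-point variable with top value 1 this map acts in one
of three ways (`ThreePointVar.step_le_of_cases`): only 1 is accepted, the two upper values are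
accepted, or everything is. In the last case the later variables do not matter, so that variable may
be observed last; otherwise the last variable observed has continuation value 0 and plays this role.
Call it `k`. A variable accepted only at 1 multiplies the loss `1 - v` by `1 - q` and does best in
front of those accepted at both upper values. Hence one may restrict to orderings `l₁, l₂, k` whose
loss is the product of `1 - q` over `l₁` times one minus a chain of affine maps `v ↦ c + (1 - d) *
v` over `l₂` (`exists_stoppingValue_le`, `le_stoppingValue`). An exchange argument orders `l₂` by
decreasing `c / d`, so after sorting only `k` and the partition remain to be found (`optCost_le`).

For fixed `k` the partition comes from a dynamic program whose state `v` is rounded down to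
multiples of `δ`. The affine maps are contractions, so rounding errors merely add up: one `δ` for
the starting value and one per row, `(n + 1) * δ` in total (`IsTable.le_optCost`). Rounding down
also guarantees that the ordering read off the table is at least as good as its entry claims
(`RealRAM.runs_trace`). Let `S` be the sum of the `E[max(X i, 0)]` and `δ = ε * S / (n * (n + 1))`.
States never exceed `S`, so about `n * (n + 1) / ε` columns suffice, and `S ≤ n * OPT` gives `(n +
1) * δ ≤ ε * OPT`.

The rounded successor of a column is monotone in the column, so two pointers fill a row in time
linear in its length (`RealRAM.runs_columns`). With `n` rows for each of `n` choices of `k` the time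
is `O(n ^ 4 / ε)`, within the required bound. -/

/-! ### Backward induction -/

/-- `E[max(X, v)]`. -/
noncomputable def ThreePointVar.step (X : ThreePointVar) (v : ℝ) : ℝ :=
  ∑ i, X.prob i * max (X.val i) v

lemma ThreePointVar.prob_nonneg (X : ThreePointVar) (i : Fin 3) : 0 ≤ X.prob i := by
  have h1 := X.p_nonneg
  have h2 := X.q_nonneg
  have h3 := X.p_add_q_le_one
  fin_cases i <;> simp [ThreePointVar.prob] <;> linarith

lemma ThreePointVar.sum_prob (X : ThreePointVar) : ∑ i, X.prob i = 1 := by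
  simp only [ThreePointVar.prob, Fin.sum_univ_three]
  simp
  ring

/-- The value of optimal stopping when the variables in the list are observed in this order. -/
noncomputable def stoppingValue (l : List ThreePointVar) : ℝ :=
  l.foldr ThreePointVar.step 0

lemma sum_prod_prob {n : ℕ} (Y : Fin n → ThreePointVar) :
    ∑ ω : Fin n → Fin 3, ∏ i, (Y i).prob (ω i) = 1 := by
  have h := Finset.prod_univ_sum (fun _ : Fin n => (Finset.univ : Finset (Fin 3)))
    (fun i j => (Y i).prob j)
  rw [Fintype.piFinset_univ] at h
  rw [← h]
  simp [ThreePointVar.sum_prob]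

/-- The stopping time for the remaining rounds after the value `y` was rejected in round `0`. -/
def StoppingTime.tail {n : ℕ} (τ : StoppingTime (n + 1)) (y : ℝ) : StoppingTime n where
  -- `Fin.last n` is a default for the case that `τ` already stops in round 0; it is never a
  -- `castSucc`, so it does not disturb adaptedness.
  time x := if h : τ.time (Fin.cons y x) = 0 then Fin.last n else (τ.time (Fin.cons y x)).pred h
  adapted := by
    intro t x x' hx ht
    have h0 : τ.time (Fin.cons y x) ≠ 0 := by
      intro h
      rw [dif_pos h] at ht
      exact absurd ht.symm (Fin.castSucc_lt_last t).ne
    rw [dif_neg h0, Fin.pred_eq_iff_eq_succ] at ht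
    have h1 : τ.time (Fin.cons y x') = t.succ.castSucc := by
      refine τ.adapted t.succ (Fin.cons y x) _ (fun s hs => ?_) (by rw [ht, Fin.succ_castSucc])
      refine Fin.cases (fun _ => rfl) (fun s hs => ?_) s hs
      rw [Fin.cons_succ, Fin.cons_succ]
      exact hx s (Fin.succ_le_succ_iff.mp hs)
    have h2 : τ.time (Fin.cons y x') ≠ 0 := by
      rw [h1, ← Fin.succ_castSucc]; exact Fin.succ_ne_zero _
    rw [dif_neg h2, Fin.pred_eq_iff_eq_succ, h1, Fin.succ_castSucc]

lemma StoppingTime.reward_of_time_eq_zero {n : ℕ} (τ : StoppingTime (n + 1)) (x : Fin (n + 1) → ℝ)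
    (h : τ.time x = 0) : τ.reward x = x 0 := by
  simp [StoppingTime.reward, h]

/-- Padding the observations with a final 0 turns the case distinction into one evaluation, and a
shift by one round into `Fin.cons_snoc_eq_snoc_cons`. -/
lemma StoppingTime.reward_eq {n : ℕ} (τ : StoppingTime n) (x : Fin n → ℝ) :
    τ.reward x = (Fin.snoc x 0 : Fin (n + 1) → ℝ) (τ.time x) := by
  unfold StoppingTime.reward
  split_ifs with h
  · simp [Fin.snoc, h]; rfl
  · simp [Fin.snoc, h]

lemma StoppingTime.reward_cons {n : ℕ} (τ : StoppingTime (n + 1)) (y : ℝ) (x : Fin n → ℝ)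
    (h : τ.time (Fin.cons y x) ≠ 0) : τ.reward (Fin.cons y x) = (τ.tail y).reward x := by
  rw [StoppingTime.reward_eq, StoppingTime.reward_eq]
  have h1 : (τ.tail y).time x = (τ.time (Fin.cons y x)).pred h := by
    simp [StoppingTime.tail, h]
  rw [h1, ← Fin.cons_snoc_eq_snoc_cons]
  conv_lhs => rw [← Fin.succ_pred _ h]
  rw [Fin.cons_succ]

lemma expectedReward_succ {n : ℕ} (Y : Fin (n + 1) → ThreePointVar) (τ : StoppingTime (n + 1)) :
    expectedReward Y τ = ∑ i, (Y 0).prob i * ∑ ω : Fin n → Fin 3,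
      (∏ j, (Y j.succ).prob (ω j)) *
        τ.reward (Fin.cons ((Y 0).val i) (fun j => (Y j.succ).val (ω j))) := by
  unfold expectedReward
  rw [← (Fin.consEquiv (fun _ : Fin (n + 1) => Fin 3)).sum_comp, Fintype.sum_prod_type]
  refine Finset.sum_congr rfl fun i _ => ?_
  rw [Finset.mul_sum]
  refine Finset.sum_congr rfl fun ω _ => ?_
  rw [Fin.prod_univ_succ, mul_assoc]
  simp only [Fin.consEquiv_apply, Fin.cons_zero, Fin.cons_succ]
  congr 3
  funext j
  refine Fin.cases ?_ (fun j => ?_) j <;> simp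

lemma stoppingValue_ofFn_succ {n : ℕ} (Y : Fin (n + 1) → ThreePointVar) :
    stoppingValue (List.ofFn Y) = (Y 0).step (stoppingValue (List.ofFn fun j => Y j.succ)) := by
  simp [stoppingValue, List.ofFn_succ]

/-- Condition on the first value. By adaptedness, a rule that stops in round 0 for one continuation
does so for all of them and earns that value; otherwise `tail` earns at most the continuation value,
by induction. -/
lemma expectedReward_le {n : ℕ} (Y : Fin n → ThreePointVar) (τ : StoppingTime n) :
    expectedReward Y τ ≤ stoppingValue (List.ofFn Y) := by
  induction n with
  | zero => simp [expectedReward, StoppingTime.reward, stoppingValue]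
  | succ n ih =>
    rw [expectedReward_succ, stoppingValue_ofFn_succ]
    refine Finset.sum_le_sum fun i _ => mul_le_mul_of_nonneg_left ?_ ((Y 0).prob_nonneg i)
    by_cases h : ∃ x : Fin n → ℝ, τ.time (Fin.cons ((Y 0).val i) x) = 0
    · obtain ⟨x, hx⟩ := h
      have h0 : ∀ x', τ.time (Fin.cons ((Y 0).val i) x') = 0 := fun x' =>
        τ.adapted 0 _ _ (fun s hs => by
          rw [Fin.le_zero_iff.mp hs]; simp) hx
      refine le_trans (le_of_eq ?_) (le_max_left _ _)
      simp_rw [StoppingTime.reward_of_time_eq_zero τ _ (h0 _), Fin.cons_zero]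
      rw [← Finset.sum_mul, sum_prod_prob (fun j : Fin n => Y j.succ), one_mul]
    · push Not at h
      refine le_trans (le_of_eq ?_) (le_trans (ih (fun j => Y j.succ) (τ.tail ((Y 0).val i)))
        (le_max_right _ _))
      simp_rw [StoppingTime.reward_cons τ _ _ (h _)]
      rfl

/-- Accept the first value if it is at least `v`, and follow `τ` otherwise. -/
noncomputable def StoppingTime.threshold {n : ℕ} (τ : StoppingTime n) (v : ℝ) :
    StoppingTime (n + 1) where
  time x := if v ≤ x 0 then 0 else (τ.time (Fin.tail x)).succ
  adapted := by
    intro t x y hx ht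
    have h0 : x 0 = y 0 := hx 0 (Fin.zero_le t)
    rw [← h0]
    split_ifs at ht ⊢ with h
    · exact ht
    · refine Fin.cases (fun _ ht => ?_) (fun t hx ht => ?_) t hx ht
      · exact absurd ht (Fin.succ_ne_zero _)
      · rw [← Fin.succ_castSucc, Fin.succ_inj] at ht ⊢
        exact τ.adapted t _ _ (fun s hs => hx s.succ (by simpa using hs)) ht

lemma exists_expectedReward_eq {n : ℕ} (Y : Fin n → ThreePointVar) :
    ∃ τ : StoppingTime n, expectedReward Y τ = stoppingValue (List.ofFn Y) := by
  induction n with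
  | zero =>
    exact ⟨⟨fun _ => 0, fun t => t.elim0⟩, by
      simp [expectedReward, StoppingTime.reward, stoppingValue]⟩
  | succ n ih =>
    obtain ⟨τ, hτ⟩ := ih (fun j => Y j.succ)
    set v := stoppingValue (List.ofFn fun j => Y j.succ) with hv
    refine ⟨τ.threshold v, ?_⟩
    rw [expectedReward_succ, stoppingValue_ofFn_succ, ← hv]
    refine Finset.sum_congr rfl fun i _ => congrArg _ ?_
    by_cases h : v ≤ (Y 0).val i
    · have h0 : ∀ x : Fin n → ℝ, (τ.threshold v).time (Fin.cons ((Y 0).val i) x) = 0 := by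
        intro x; simp [StoppingTime.threshold, h]
      simp_rw [StoppingTime.reward_of_time_eq_zero _ _ (h0 _), Fin.cons_zero]
      rw [← Finset.sum_mul, sum_prod_prob (fun j : Fin n => Y j.succ), one_mul, max_eq_left h]
    · have h0 : ∀ x : Fin n → ℝ, (τ.threshold v).time (Fin.cons ((Y 0).val i) x) =
          (τ.time x).succ := by
        intro x; simp [StoppingTime.threshold, h]
      rw [max_eq_right (le_of_not_ge h)]
      refine Eq.trans ?_ hτ
      refine Finset.sum_congr rfl fun ω _ => congrArg _ ?_
      rw [StoppingTime.reward_eq, StoppingTime.reward_eq, h0, ← Fin.cons_snoc_eq_snoc_cons,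
        Fin.cons_succ]

/-- The value of an ordering is computed by backward induction. -/
lemma orderingValue_eq {n : ℕ} (X : Fin n → ThreePointVar) (σ : Equiv.Perm (Fin n)) :
    orderingValue X σ = stoppingValue (List.ofFn fun t => X (σ t)) := by
  obtain ⟨τ, hτ⟩ := exists_expectedReward_eq (fun t => X (σ t))
  have hb := expectedReward_le (fun t => X (σ t))
  have : Nonempty (StoppingTime n) := ⟨τ⟩
  refine le_antisymm (ciSup_le hb) ?_
  rw [← hτ]
  exact le_ciSup (f := fun τ => expectedReward (fun t => X (σ t)) τ)
    ⟨_, Set.forall_mem_range.mpr hb⟩ τ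

/-! ### Orderings in which a variable is either accepted only at `1` or at its two upper values -/

namespace ThreePointVar

variable (X : ThreePointVar)

/-- The part of the expectation coming from the two upper values. -/
def upperMean : ℝ := X.q + X.p * X.m

/-- The probability of the two upper values. -/
def upperProb : ℝ := X.p + X.q

lemma upperMean_nonneg : 0 ≤ X.upperMean :=
  add_nonneg X.q_nonneg (mul_nonneg X.p_nonneg X.m_nonneg)

lemma upperMean_le_upperProb : X.upperMean ≤ X.upperProb := by
  have := mul_le_mul_of_nonneg_left X.m_le_one X.p_nonneg
  unfold upperMean upperProb
  linarith

lemma upperProb_nonneg : 0 ≤ X.upperProb := add_nonneg X.p_nonneg X.q_nonneg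

lemma upperProb_le_one : X.upperProb ≤ 1 := X.p_add_q_le_one

lemma q_le_one : X.q ≤ 1 := by linarith [X.p_nonneg, X.p_add_q_le_one]

/-- If `p + q = 0` the mean vanishes as well, so the convention `0 / 0 = 0` gives a usable key and
no variable is exceptional. -/
lemma upperMean_eq : X.upperMean = X.upperMean / X.upperProb * X.upperProb := by
  rcases eq_or_ne X.upperProb 0 with h | h
  · have := X.upperMean_le_upperProb
    have := X.upperMean_nonneg
    rw [h, mul_zero]
    linarith
  · rw [div_mul_cancel₀ _ h]

lemma step_eq (v : ℝ) :
    X.step v = (1 - X.p - X.q) * max X.a v + X.p * max X.m v + X.q * max 1 v := by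
  simp only [step, prob, val, Fin.sum_univ_three]
  simp

lemma step_mono {v w : ℝ} (h : v ≤ w) : X.step v ≤ X.step w :=
  Finset.sum_le_sum fun i _ =>
    mul_le_mul_of_nonneg_left (max_le_max_left _ h) (X.prob_nonneg i)

lemma prob_lower_nonneg : 0 ≤ 1 - X.p - X.q := by linarith [X.p_add_q_le_one]

/-- Accepting only 1 is one particular rule, hence a lower bound for every `v`; `le_step_upper` uses
the rule accepting both upper values. -/
lemma le_step_top (v : ℝ) : X.q + (1 - X.q) * v ≤ X.step v := by
  rw [step_eq]
  have h1 := mul_le_mul_of_nonneg_left (le_max_right X.a v) X.prob_lower_nonneg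
  have h2 := mul_le_mul_of_nonneg_left (le_max_right X.m v) X.p_nonneg
  have h3 := mul_le_mul_of_nonneg_left (le_max_left 1 v) X.q_nonneg
  linarith

lemma le_step_upper (v : ℝ) : X.upperMean + (1 - X.upperProb) * v ≤ X.step v := by
  rw [step_eq, upperMean, upperProb]
  have h1 := mul_le_mul_of_nonneg_left (le_max_right X.a v) X.prob_lower_nonneg
  have h2 := mul_le_mul_of_nonneg_left (le_max_left X.m v) X.p_nonneg
  have h3 := mul_le_mul_of_nonneg_left (le_max_left 1 v) X.q_nonneg
  linarith

lemma le_step {v : ℝ} (hv : v ≤ 1) : v ≤ X.step v := by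
  have := X.le_step_top v
  have := mul_nonneg X.q_nonneg (sub_nonneg.mpr hv)
  linarith

lemma step_le_one {v : ℝ} (hv : v ≤ 1) : X.step v ≤ 1 := by
  rw [step_eq]
  have h1 := mul_le_mul_of_nonneg_left (max_le (X.a_lt_m.le.trans X.m_le_one) hv)
    X.prob_lower_nonneg
  have h2 := mul_le_mul_of_nonneg_left (max_le X.m_le_one hv) X.p_nonneg
  have h3 := mul_le_mul_of_nonneg_left (max_le le_rfl hv) X.q_nonneg
  linarith

lemma upperMean_le_step_zero : X.upperMean ≤ X.step 0 := by
  simpa using X.le_step_upper 0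

lemma step_zero_nonneg : 0 ≤ X.step 0 := X.upperMean_nonneg.trans X.upperMean_le_step_zero

lemma step_zero_eq : X.step 0 =
    X.upperMean + (1 - X.upperProb) * (if X.a < 0 then 0 else X.a) := by
  rw [step_eq, max_eq_left X.m_nonneg, max_eq_left zero_le_one, upperMean, upperProb]
  split_ifs with h
  · rw [max_eq_right h.le]; ring
  · rw [max_eq_left (not_lt.mp h)]; ring

/-- The three cases are `m ≤ v`, `a ≤ v ≤ m` and `v ≤ a`. In the last one `0 ≤ v ≤ a`, so replacing
the continuation value by 0 changes nothing. -/
lemma step_le_of_cases {v : ℝ} (h0 : 0 ≤ v) (h1 : v ≤ 1) :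
    X.step v = X.q + (1 - X.q) * v ∨ X.step v = X.upperMean + (1 - X.upperProb) * v ∨
      X.step v = X.step 0 := by
  rw [step_eq, step_eq, upperMean, upperProb, max_eq_left h1]
  rcases le_total X.m v with h | h
  · left
    rw [max_eq_right h, max_eq_right (X.a_lt_m.le.trans h)]
    ring
  · right
    rcases le_total X.a v with h' | h'
    · left
      rw [max_eq_left h, max_eq_right h']
      ring
    · right
      rw [max_eq_left h, max_eq_left h', max_eq_left (h0.trans h'), max_eq_left X.m_nonneg,
        max_eq_left zero_le_one]

end ThreePointVar

lemma stoppingValue_cons (X : ThreePointVar) (l : List ThreePointVar) :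
    stoppingValue (X :: l) = X.step (stoppingValue l) := rfl

lemma stoppingValue_nonneg_le_one (l : List ThreePointVar) :
    0 ≤ stoppingValue l ∧ stoppingValue l ≤ 1 := by
  induction l with
  | nil => simp [stoppingValue]
  | cons X l ih =>
    rw [stoppingValue_cons]
    exact ⟨ih.1.trans (X.le_step ih.2), X.step_le_one ih.2⟩

/-! ### The loss of a partition, and the exchange argument -/

section Affine

variable {ι : Type*} (q c d : ι → ℝ)

/-- The composition of the maps `v ↦ c x + (1 - d x) * v`, the last one in the list applied
first. -/
noncomputable def affineChain (l : List ι) (v : ℝ) : ℝ :=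
  l.foldr (fun x w => c x + (1 - d x) * w) v

/-- The product of the factors `1 - q x`. -/
noncomputable def missProb (l : List ι) : ℝ := (l.map fun x => 1 - q x).prod

@[simp] lemma affineChain_nil (v : ℝ) : affineChain c d [] v = v := rfl

@[simp] lemma affineChain_cons (x : ι) (l : List ι) (v : ℝ) :
    affineChain c d (x :: l) v = c x + (1 - d x) * affineChain c d l v := rfl

@[simp] lemma missProb_nil : missProb q [] = 1 := rfl

@[simp] lemma missProb_cons (x : ι) (l : List ι) :
    missProb q (x :: l) = (1 - q x) * missProb q l := by simp [missProb]

lemma missProb_perm {l l' : List ι} (h : l.Perm l') : missProb q l = missProb q l' :=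
  (h.map _).prod_eq

variable {q c d}

lemma missProb_nonneg (hq : ∀ x, q x ≤ 1) (l : List ι) : 0 ≤ missProb q l := by
  induction l with
  | nil => simp
  | cons x l ih => rw [missProb_cons]; exact mul_nonneg (sub_nonneg.mpr (hq x)) ih

lemma missProb_le_one (hq : ∀ x, 0 ≤ q x) (hq1 : ∀ x, q x ≤ 1) (l : List ι) :
    missProb q l ≤ 1 := by
  induction l with
  | nil => simp
  | cons x l ih =>
    rw [missProb_cons]
    exact mul_le_one₀ (by linarith [hq x]) (missProb_nonneg hq1 l) ih

lemma affineChain_mono (hd : ∀ x, d x ≤ 1) (l : List ι) {v w : ℝ} (h : v ≤ w) :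
    affineChain c d l v ≤ affineChain c d l w := by
  induction l with
  | nil => simpa
  | cons x l ih =>
    rw [affineChain_cons, affineChain_cons]
    linarith [mul_le_mul_of_nonneg_left ih (sub_nonneg.mpr (hd x))]

lemma affineChain_append (l l' : List ι) (v : ℝ) :
    affineChain c d (l ++ l') v = affineChain c d l (affineChain c d l' v) := by
  simp [affineChain]

/-- Swapping two adjacent maps changes the value by `d x * d y * (key y - key x)`, whatever `v` is.
So the map with the smaller key should be applied earlier, and `x` passes the elements of `l` one at
a time. -/
lemma affineChain_move {key : ι → ℝ} (hc : ∀ x, c x = key x * d x) (hd0 : ∀ x, 0 ≤ d x)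
    (hd : ∀ x, d x ≤ 1) (x : ι) (l : List ι) (v : ℝ) (h : ∀ y ∈ l, key x ≤ key y) :
    affineChain c d (x :: l) v ≤ affineChain c d l (c x + (1 - d x) * v) := by
  induction l with
  | nil => simp
  | cons y l ih =>
    have ih := ih fun z hz => h z (List.mem_cons_of_mem _ hz)
    have hy := h y List.mem_cons_self
    have h1 := mul_le_mul_of_nonneg_left ih (sub_nonneg.mpr (hd y))
    have h2 := mul_le_mul_of_nonneg_right hy (mul_nonneg (hd0 x) (hd0 y))
    simp only [affineChain_cons] at h1 ⊢
    refine le_trans ?_ (add_le_add_right h1 _)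
    rw [hc x, hc y]
    linarith

variable (q c d)

/-- The least value of `missProb q l₁ * (1 - affineChain c d l₂ v)` over the partitions of the
list into two subsequences `l₁` and `l₂`, the first element being applied first. -/
noncomputable def optCost : List ι → ℝ → ℝ
  | [], v => 1 - v
  | x :: l, v => min ((1 - q x) * optCost l v) (optCost l (c x + (1 - d x) * v))

variable {q c d}

/-- Decide where the head `x` lies. In `l₁` its factor can be pulled out; in `l₂` it has the least
key, so `affineChain_move` brings it to the innermost place without increasing the loss. -/
lemma optCost_le {key : ι → ℝ} (hq : ∀ x, q x ≤ 1) (hc : ∀ x, c x = key x * d x)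
    (hd0 : ∀ x, 0 ≤ d x) (hd : ∀ x, d x ≤ 1) {l : List ι}
    (hl : l.Pairwise fun x y => key x ≤ key y) (l₁ l₂ : List ι) (h : l.Perm (l₁ ++ l₂)) (v : ℝ) :
    optCost q c d l v ≤ missProb q l₁ * (1 - affineChain c d l₂ v) := by
  induction l generalizing l₁ l₂ v with
  | nil =>
    obtain ⟨rfl, rfl⟩ := List.append_eq_nil_iff.mp h.nil_eq.symm
    simp [optCost]
  | cons x l ih =>
    rw [List.pairwise_cons] at hl
    rcases List.mem_append.mp (h.subset List.mem_cons_self) with hx | hx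
    · obtain ⟨s, t, rfl⟩ := List.append_of_mem hx
      have hp : (s ++ x :: t).Perm (x :: (s ++ t)) := List.perm_middle
      rw [missProb_perm q hp, missProb_cons, mul_assoc]
      refine (min_le_left _ _).trans (mul_le_mul_of_nonneg_left ?_ (sub_nonneg.mpr (hq x)))
      exact ih hl.2 (s ++ t) l₂ ((h.trans (hp.append_right _)).cons_inv) v
    · obtain ⟨s, t, rfl⟩ := List.append_of_mem hx
      have hp : (l₁ ++ (s ++ x :: t)).Perm (x :: (l₁ ++ (s ++ t))) := by
        rw [← List.append_assoc, ← List.append_assoc]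
        exact List.perm_middle
      have hl' : l.Perm (l₁ ++ (s ++ t)) := (h.trans hp).cons_inv
      refine (min_le_right _ _).trans ((ih hl.2 l₁ (s ++ t) hl' _).trans ?_)
      refine mul_le_mul_of_nonneg_left (sub_le_sub_left ?_ _) (missProb_nonneg hq _)
      rw [affineChain_append, affineChain_append]
      refine affineChain_mono hd s (affineChain_move hc hd0 hd x t v fun y hy => hl.1 y ?_)
      exact hl'.symm.subset (by simp [hy])

end Affine

/-! ### Reduction to orderings of the form `l₁, l₂, k` -/

section Reduction

variable {ι : Type*} (X : ι → ThreePointVar)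

/-- Prepend one variable at a time. If accepted only at 1, it joins `l₁`. If accepted at its two
upper values, it joins `l₂` behind all of `l₁`, which gains `(1 - missProb l₁) * (upperProb -
upperMean) ≥ 0`. If always accepted, it becomes the new `k`, and everything after it goes to `l₁`,
where it can only help. -/
lemma exists_stoppingValue_le (s : List ι) (hs : s ≠ []) :
    ∃ (k : ι) (l₁ l₂ : List ι), s.Perm (k :: (l₁ ++ l₂)) ∧
      stoppingValue (s.map X) ≤ 1 - missProb (fun x => (X x).q) l₁ *
        (1 - affineChain (fun x => (X x).upperMean) (fun x => (X x).upperProb) l₂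
          ((X k).step 0)) := by
  induction s with
  | nil => exact absurd rfl hs
  | cons x s ih =>
    rcases eq_or_ne s [] with rfl | hs'
    · exact ⟨x, [], [], by simp, by simp [stoppingValue]⟩
    obtain ⟨k, l₁, l₂, hp, hv⟩ := ih hs'
    rw [List.map_cons, stoppingValue_cons]
    have hq := missProb_nonneg (fun x => (X x).q_le_one) l₁
    have hq1 := missProb_le_one (fun x => (X x).q_nonneg) (fun x => (X x).q_le_one) l₁
    obtain ⟨hb0, hb1⟩ := stoppingValue_nonneg_le_one (s.map X)
    rcases (X x).step_le_of_cases hb0 hb1 with h | h | h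
    · refine ⟨k, x :: l₁, l₂, ?_, ?_⟩
      · exact (hp.cons x).trans (List.Perm.swap _ _ _)
      · rw [h, missProb_cons]
        linarith [mul_le_mul_of_nonneg_left hv (sub_nonneg.mpr (X x).q_le_one)]
    · refine ⟨k, l₁, x :: l₂, ?_, ?_⟩
      · refine (hp.cons x).trans ((List.Perm.swap _ _ _).trans (List.Perm.cons k ?_))
        exact List.perm_middle.symm
      · rw [h, affineChain_cons]
        have h1 := mul_le_mul_of_nonneg_left hv (sub_nonneg.mpr (X x).upperProb_le_one)
        have h2 := mul_nonneg (sub_nonneg.mpr hq1)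
          (sub_nonneg.mpr (X x).upperMean_le_upperProb)
        linarith
    · refine ⟨x, k :: (l₁ ++ l₂), [], ?_, ?_⟩
      · simpa using hp.cons x
      · rw [h, affineChain_nil]
        have h1 := missProb_le_one (fun x => (X x).q_nonneg) (fun x => (X x).q_le_one)
          (k :: (l₁ ++ l₂))
        have h2 := mul_nonneg (sub_nonneg.mpr h1)
          (sub_nonneg.mpr ((X x).step_le_one zero_le_one))
        linarith

/-- The rule prescribed by the partition earns the left-hand side, and optimal stopping in the same
order earns no less. A good partition is therefore enough; its rule need not be optimal. -/
lemma le_stoppingValue (k : ι) (l₁ l₂ : List ι) :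
    1 - missProb (fun x => (X x).q) l₁ *
        (1 - affineChain (fun x => (X x).upperMean) (fun x => (X x).upperProb) l₂
          ((X k).step 0)) ≤ stoppingValue ((l₁ ++ (l₂ ++ [k])).map X) := by
  induction l₁ with
  | nil =>
    rw [missProb_nil, one_mul, sub_sub_cancel, List.nil_append]
    induction l₂ with
    | nil => simp [stoppingValue]
    | cons x l ih =>
      rw [affineChain_cons, List.cons_append, List.map_cons, stoppingValue_cons]
      refine le_trans ?_ ((X x).le_step_upper _)
      linarith [mul_le_mul_of_nonneg_left ih (sub_nonneg.mpr (X x).upperProb_le_one)]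
  | cons x l ih =>
    rw [missProb_cons, List.cons_append, List.map_cons, stoppingValue_cons]
    refine le_trans ?_ ((X x).le_step_top _)
    linarith [mul_le_mul_of_nonneg_left ih (sub_nonneg.mpr (X x).q_le_one)]

variable [DecidableEq ι]

lemma missProb_update (q : ι → ℝ) (k : ι) (y : ℝ) (l : List ι) (h : k ∉ l) :
    missProb (Function.update q k y) l = missProb q l := by
  unfold missProb
  refine congrArg _ (List.map_congr_left fun x hx => ?_)
  rw [Function.update_of_ne (by rintro rfl; exact h hx)]

lemma affineChain_update (c d : ι → ℝ) (k : ι) (y z : ℝ) (l : List ι) (h : k ∉ l) (v : ℝ) :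
    affineChain (Function.update c k y) (Function.update d k z) l v = affineChain c d l v := by
  induction l with
  | nil => simp
  | cons x l ih =>
    rw [List.mem_cons, not_or] at h
    rw [affineChain_cons, affineChain_cons, ih h.2, Function.update_of_ne (Ne.symm h.1),
      Function.update_of_ne (Ne.symm h.1)]

/-- `optCost` for the variables other than `k`, the variable `k` being observed last. -/
noncomputable def lastCost (k : ι) (l : List ι) : ℝ → ℝ :=
  optCost (Function.update (fun x => (X x).q) k 0) (Function.update (fun x => (X x).upperMean) k 0)
    (Function.update (fun x => (X x).upperProb) k 0) l

/-- With its parameters set to zero, both maps of `k` are the identity. So `k` may stay in the list,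
counted in `l₁` at no cost, and a single sorted list serves every choice of `k`. -/
lemma exists_stoppingValue_le_lastCost (s l : List ι) (hs : s ≠ []) (hnd : s.Nodup)
    (hl : l.Pairwise fun x y =>
      (X x).upperMean / (X x).upperProb ≤ (X y).upperMean / (X y).upperProb) (hp : l.Perm s) :
    ∃ k ∈ s, stoppingValue (s.map X) ≤ 1 - lastCost X k l ((X k).step 0) := by
  obtain ⟨k, l₁, l₂, hs', hv⟩ := exists_stoppingValue_le X s hs
  have hk : k ∉ l₁ ++ l₂ := ((hs'.nodup_iff.mp hnd)).notMem
  rw [List.mem_append, not_or] at hk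
  refine ⟨k, hs'.symm.subset List.mem_cons_self, hv.trans (sub_le_sub_left ?_ _)⟩
  have hu : ∀ (f : ι → ℝ) (P : ℝ → Prop), P 0 → (∀ x, P (f x)) →
      ∀ x, P (Function.update f k 0 x) := by
    intro f P h0 h x
    rcases eq_or_ne x k with rfl | hx
    · rwa [Function.update_self]
    · rw [Function.update_of_ne hx]; exact h x
  refine (optCost_le (hu _ (· ≤ 1) zero_le_one fun x => (X x).q_le_one) ?_
    (hu _ (0 ≤ ·) le_rfl fun x => (X x).upperProb_nonneg)
    (hu _ (· ≤ 1) zero_le_one fun x => (X x).upperProb_le_one) hl (k :: l₁) l₂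
    (hp.trans hs') _).trans (le_of_eq ?_)
  · intro x
    rcases eq_or_ne x k with rfl | hx
    · simp
    · rw [Function.update_of_ne hx, Function.update_of_ne hx]
      exact (X x).upperMean_eq
  · rw [missProb_cons, missProb_update _ _ _ _ hk.1, affineChain_update _ _ _ _ _ _ hk.2]
    simp

end Reduction

/-! ### The rounded dynamic program -/

/-- The first `t` values of a sequence, the latest one first. -/
def revPrefix (x : ℕ → ℕ) : ℕ → List ℕ
  | 0 => []
  | t + 1 => x t :: revPrefix x t

lemma revPrefix_eq (x : ℕ → ℕ) (t : ℕ) : revPrefix x t = ((List.range t).map x).reverse := by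
  induction t with
  | zero => rfl
  | succ t ih => simp [revPrefix, ih, List.range_succ]

/-- The entry `w` of a new row in column `g` is the smaller one of `(1 - q) * W g` and `W h`, where
`h` is `(c + (1 - d) * (g * δ)) / δ` rounded down and truncated to the interval from `g` to `G`; the
next column is `g` in the first case and `h` in the second one. -/
def CellSpec (G : ℕ) (δ q c d : ℝ) (W : ℕ → ℝ) (g : ℕ) (w : ℝ) (next : ℕ) : Prop :=
  ∃ h, g ≤ h ∧ h ≤ G ∧ (h = g ∨ (h : ℝ) * δ ≤ c + (1 - d) * (g * δ)) ∧
    (h = G ∨ c + (1 - d) * (g * δ) < ((h : ℝ) + 1) * δ) ∧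
    ((1 - q) * W g ≤ W h ∧ w = (1 - q) * W g ∧ next = g ∨
      W h < (1 - q) * W g ∧ w = W h ∧ next = h)

/-- The rows `0, …, n` of the dynamic program, for the sequence `x` of variables. -/
structure IsTable (n G : ℕ) (δ : ℝ) (q c d : ℕ → ℝ) (x : ℕ → ℕ) (W : ℕ → ℕ → ℝ)
    (next : ℕ → ℕ → ℕ) : Prop where
  init : ∀ g ≤ G, W 0 g = max 0 (1 - g * δ)
  cell : ∀ t < n, ∀ g ≤ G,
    CellSpec G δ (q (x t)) (c (x t)) (d (x t)) (W t) g (W (t + 1) g) (next t g)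

namespace IsTable

variable {n G : ℕ} {δ : ℝ} {q c d : ℕ → ℝ} {x : ℕ → ℕ} {W : ℕ → ℕ → ℝ} {next : ℕ → ℕ → ℕ}

lemma nonneg (H : IsTable n G δ q c d x W next) (hq : ∀ y, q y ≤ 1) {t : ℕ} (ht : t ≤ n) :
    ∀ g ≤ G, 0 ≤ W t g := by
  induction t with
  | zero => intro g hg; rw [H.init g hg]; exact le_max_left _ _
  | succ t ih =>
    intro g hg
    obtain ⟨h, -, hG, -, -, ⟨-, hw, -⟩ | ⟨-, hw, -⟩⟩ := H.cell t ht g hg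
    · rw [hw]; exact mul_nonneg (sub_nonneg.mpr (hq _)) (ih (Nat.le_of_succ_le ht) g hg)
    · rw [hw]; exact ih (Nat.le_of_succ_le ht) h hG

/-- Truncation from below at `g` is harmless: if `h = g`, nonnegativity gives `(1 - q) * W g ≤ W h`
and the first alternative is taken. Hence a change of column always comes from a genuine rounding
down, and an unchanged column identifies a member of `l₁`. -/
lemma next_spec (H : IsTable n G δ q c d x W next) (hq0 : ∀ y, 0 ≤ q y) (hq : ∀ y, q y ≤ 1)
    {t g : ℕ} (ht : t < n) (hg : g ≤ G) :
    (next t g = g ∧ W (t + 1) g = (1 - q (x t)) * W t g) ∨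
      (g < next t g ∧ next t g ≤ G ∧
        (next t g : ℝ) * δ ≤ c (x t) + (1 - d (x t)) * (g * δ) ∧ W (t + 1) g = W t (next t g)) := by
  obtain ⟨h, hgh, hG, h1, -, ⟨-, hw, hn⟩ | ⟨hlt, hw, hn⟩⟩ := H.cell t ht g hg
  · exact Or.inl ⟨hn, hw⟩
  · right
    have hne : h ≠ g := by
      rintro rfl
      have := mul_nonneg (hq0 (x t)) (H.nonneg hq ht.le h hg)
      linarith
    rw [hn]
    exact ⟨lt_of_le_of_ne hgh hne.symm, hG, h1.resolve_left hne, hw⟩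

/-- Here `s` is the accumulated error in units of `δ`: the true state exceeds column `g` by at most
`s` columns. As `v ↦ c + (1 - d) * v` is a contraction, each row adds at most one unit. The bound
`hvG` keeps all reachable states inside the grid. -/
lemma le_optCost (H : IsTable n G δ q c d x W next) (hq0 : ∀ y, 0 ≤ q y) (hq : ∀ y, q y ≤ 1)
    (hδ : 0 ≤ δ) (hc : ∀ y, 0 ≤ c y) (hcd : ∀ y, c y ≤ d y) (hd : ∀ y, d y ≤ 1) {t : ℕ}
    (ht : t ≤ n) {g : ℕ} (hg : g ≤ G) {s v : ℝ} (hs : 0 ≤ s) (hv0 : 0 ≤ v) (hv1 : v ≤ 1)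
    (hv : v ≤ (g + s) * δ) (hvG : v + ∑ i ∈ Finset.range t, c (x i) ≤ G * δ) :
    W t g ≤ optCost q c d (revPrefix x t) v + (s + t) * δ := by
  induction t generalizing g s v with
  | zero =>
    rw [H.init g hg, revPrefix, optCost]
    have := mul_nonneg hs hδ
    push_cast
    exact max_le (by linarith) (by linarith)
  | succ t ih =>
    rw [Finset.sum_range_succ] at hvG
    have hct := hc (x t)
    have hsum : 0 ≤ ∑ i ∈ Finset.range t, c (x i) := Finset.sum_nonneg fun i _ => hc (x i)
    have hdt : 0 ≤ d (x t) := hct.trans (hcd _)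
    obtain ⟨h, hgh, hG, -, h2, h3⟩ := H.cell t ht g hg
    have hW := H.nonneg hq (Nat.le_of_succ_le ht) g hg
    have hmin : W (t + 1) g ≤ (1 - q (x t)) * W t g ∧ W (t + 1) g ≤ W t h := by
      rcases h3 with ⟨hle, hw, -⟩ | ⟨hlt, hw, -⟩
      · exact ⟨hw.le, hw.le.trans hle⟩
      · exact ⟨hw.le.trans hlt.le, hw.le⟩
    have ht0 : (0 : ℝ) ≤ t := Nat.cast_nonneg t
    rw [revPrefix, optCost]
    push_cast
    rcases min_choice ((1 - q (x t)) * optCost q c d (revPrefix x t) v)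
      (optCost q c d (revPrefix x t) (c (x t) + (1 - d (x t)) * v)) with hm | hm
    · rw [hm]
      have h4 := mul_le_mul_of_nonneg_left
        (ih (Nat.le_of_succ_le ht) hg hs hv0 hv1 hv (by linarith)) (sub_nonneg.mpr (hq (x t)))
      have h5 := mul_nonneg (hq0 (x t)) (mul_nonneg (add_nonneg hs ht0) hδ)
      linarith [hmin.1]
    · rw [hm]
      have hdv := mul_nonneg hdt hv0
      have h4 := ih (Nat.le_of_succ_le ht) hG (s := s + 1) (v := c (x t) + (1 - d (x t)) * v)
        (by linarith) (add_nonneg hct (mul_nonneg (sub_nonneg.mpr (hd _)) hv0))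
        (by linarith [mul_le_mul_of_nonneg_left hv1 (sub_nonneg.mpr (hd (x t))), hcd (x t)])
        ?_ (by linarith)
      · linarith [hmin.2]
      -- If the column was truncated at `G`, the new state is at most `G * δ` by `hvG`; otherwise
      -- rounding loses less than one `δ`.
      · rcases h2 with rfl | h2
        · linarith [mul_nonneg (show 0 ≤ s + 1 by linarith) hδ]
        · have h5 := mul_le_mul_of_nonneg_left hv (sub_nonneg.mpr (hd (x t)))
          have h6 := mul_nonneg hdt (mul_nonneg hs hδ)
          linarith

end IsTable

/-! ### Total correctness and running times of programs -/

namespace RealRAM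

@[simp] lemma State.setIdx_idx (s : State) (A i v B j : ℕ) :
    (s.setIdx A i v).idx B j = if B = A ∧ j = i then v else s.idx B j := by
  simp only [State.setIdx, Function.update_apply]
  split_ifs <;> simp_all

@[simp] lemma State.setIdx_idx_of_ne (s : State) {A B : ℕ} (h : B ≠ A) (i v : ℕ) :
    (s.setIdx A i v).idx B = s.idx B := by
  simp [State.setIdx, Function.update_of_ne h]

@[simp] lemma State.setIdx_real (s : State) (A i v : ℕ) : (s.setIdx A i v).real = s.real := rfl

@[simp] lemma State.setReal_idx (s : State) (A i : ℕ) (v : ℝ) :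
    (s.setReal A i v).idx = s.idx := rfl

@[simp] lemma State.setReal_real (s : State) (A i : ℕ) (v : ℝ) (B j : ℕ) :
    (s.setReal A i v).real B j = if B = A ∧ j = i then v else s.real B j := by
  simp only [State.setReal, Function.update_apply]
  split_ifs <;> simp_all

/-- Started in `s`, the program halts after at most `T` operations in a state satisfying `Φ`. -/
def Runs (P : Prog) (s : State) (T : ℕ) (Φ : State → Prop) : Prop :=
  ∃ t s', Exec P s t s' ∧ t ≤ T ∧ Φ s'

/-- The effect of a program without loops. -/
noncomputable def Prog.flat : Prog → State → State
  | skip, s => s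
  | setIdx A i e, s => s.setIdx A (i.eval s) (e.eval s)
  | setReal A i e, s => s.setReal A (i.eval s) (e.eval s)
  | seq P Q, s => Q.flat (P.flat s)
  | ite b P Q, s => open Classical in if b.Holds s then P.flat s else Q.flat s
  | loop _ _, s => s

/-- The program has no loops. -/
def Prog.IsFlat : Prog → Prop
  | seq P Q => P.IsFlat ∧ Q.IsFlat
  | ite _ P Q => P.IsFlat ∧ Q.IsFlat
  | loop _ _ => False
  | _ => True

/-- An upper bound for the running time of a program without loops. -/
def Prog.flatCost : Prog → ℕ
  | skip => 1
  | setIdx _ i e => i.cost + e.cost + 1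
  | setReal _ i e => i.cost + e.cost + 1
  | seq P Q => P.flatCost + Q.flatCost
  | ite b P Q => b.cost + (P.flatCost + Q.flatCost) + 1
  | loop b _ => b.cost + 1

/-- Loop-free code is handled by evaluating `flat` and `flatCost`, so that only loops need
invariants. -/
lemma exec_flat (P : Prog) (h : P.IsFlat) (s : State) :
    ∃ t ≤ P.flatCost, Exec P s t (P.flat s) := by
  induction P generalizing s with
  | skip => exact ⟨_, le_rfl, Exec.skip s⟩
  | setIdx A i e => exact ⟨_, le_rfl, Exec.setIdx A i e s⟩
  | setReal A i e => exact ⟨_, le_rfl, Exec.setReal A i e s⟩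
  | seq P Q ihP ihQ =>
    obtain ⟨t, ht, hP⟩ := ihP h.1 s
    obtain ⟨u, hu, hQ⟩ := ihQ h.2 (P.flat s)
    exact ⟨t + u, add_le_add ht hu, Exec.seq hP hQ⟩
  | ite b P Q ihP ihQ =>
    by_cases hb : b.Holds s
    · obtain ⟨t, ht, hP⟩ := ihP h.1 s
      refine ⟨b.cost + t + 1, by simp only [Prog.flatCost]; lia, ?_⟩
      simpa [Prog.flat, hb] using Exec.iteTrue hb hP
    · obtain ⟨t, ht, hQ⟩ := ihQ h.2 s
      refine ⟨b.cost + t + 1, by simp only [Prog.flatCost]; lia, ?_⟩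
      simpa [Prog.flat, hb] using Exec.iteFalse hb hQ
  | loop b P => exact h.elim

/-- The index arrays to which the program may write. -/
def Prog.idxWrites : Prog → List ℕ
  | setIdx A _ _ => [A]
  | seq P Q => P.idxWrites ++ Q.idxWrites
  | ite _ P Q => P.idxWrites ++ Q.idxWrites
  | loop _ P => P.idxWrites
  | _ => []

/-- The real arrays to which the program may write. -/
def Prog.realWrites : Prog → List ℕ
  | setReal A _ _ => [A]
  | seq P Q => P.realWrites ++ Q.realWrites
  | ite _ P Q => P.realWrites ++ Q.realWrites
  | loop _ P => P.realWrites
  | _ => []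

/-- The arrays to which the program does not write are the same in both states. -/
def Prog.Frame (P : Prog) (s s' : State) : Prop :=
  (∀ A, A ∉ P.idxWrites → s'.idx A = s.idx A) ∧ ∀ A, A ∉ P.realWrites → s'.real A = s.real A

namespace Prog.Frame

variable {P Q : Prog} {s s' s'' : State}

lemma refl (P : Prog) (s : State) : P.Frame s s := ⟨fun _ _ => rfl, fun _ _ => rfl⟩

lemma trans (h : P.Frame s s') (h' : P.Frame s' s'') : P.Frame s s'' :=
  ⟨fun A hA => (h'.1 A hA).trans (h.1 A hA), fun A hA => (h'.2 A hA).trans (h.2 A hA)⟩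

lemma mono (h : P.Frame s s') (hi : P.idxWrites ⊆ Q.idxWrites)
    (hr : P.realWrites ⊆ Q.realWrites) : Q.Frame s s' :=
  ⟨fun A hA => h.1 A fun h => hA (hi h), fun A hA => h.2 A fun h => hA (hr h)⟩

end Prog.Frame

/-- The write sets are syntactic, so that an array survives a subprogram can be settled by `decide`.
-/
lemma Exec.frame {P : Prog} {s s' : State} {t : ℕ} (h : Exec P s t s') : P.Frame s s' := by
  induction h with
  | skip s => exact .refl _ _
  | setIdx A i e s =>
    refine ⟨fun B hB => ?_, fun _ _ => rfl⟩
    have : B ≠ A := by simpa [Prog.idxWrites] using hB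
    simp [State.setIdx, Function.update_of_ne this]
  | setReal A i e s =>
    refine ⟨fun _ _ => rfl, fun B hB => ?_⟩
    have : B ≠ A := by simpa [Prog.realWrites] using hB
    simp [State.setReal, Function.update_of_ne this]
  | seq _ _ ih1 ih2 =>
    exact (ih1.mono (List.subset_append_left _ _) (List.subset_append_left _ _)).trans
      (ih2.mono (List.subset_append_right _ _) (List.subset_append_right _ _))
  | iteTrue _ _ ih => exact ih.mono (List.subset_append_left _ _) (List.subset_append_left _ _)
  | iteFalse _ _ ih => exact ih.mono (List.subset_append_right _ _) (List.subset_append_right _ _)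
  | loopTrue _ _ _ ih1 ih2 =>
    exact Prog.Frame.trans (ih1.mono (List.Subset.refl _) (List.Subset.refl _)) ih2
  | loopFalse _ => exact .refl _ _

namespace Runs

variable {P Q : Prog} {s : State} {T U : ℕ} {Φ Ψ : State → Prop}

lemma mono (h : Runs P s T Φ) (hT : T ≤ U) (hΦ : ∀ s', P.Frame s s' → Φ s' → Ψ s') :
    Runs P s U Ψ := by
  obtain ⟨t, s', he, ht, hs⟩ := h
  exact ⟨t, s', he, ht.trans hT, hΦ s' he.frame hs⟩

lemma flat (hP : P.IsFlat) (hT : P.flatCost ≤ T) (hΦ : P.Frame s (P.flat s) → Φ (P.flat s)) :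
    Runs P s T Φ := by
  obtain ⟨t, ht, he⟩ := exec_flat P hP s
  exact ⟨t, _, he, ht.trans hT, hΦ he.frame⟩

lemma seq (hP : Runs P s T Φ) (hQ : ∀ s', P.Frame s s' → Φ s' → Runs Q s' U Ψ) :
    Runs (Prog.seq P Q) s (T + U) Ψ := by
  obtain ⟨t, s', he, ht, hs⟩ := hP
  obtain ⟨u, s'', he', hu, hs'⟩ := hQ s' he.frame hs
  exact ⟨t + u, s'', Exec.seq he he', add_le_add ht hu, hs'⟩

lemma ite {b : Test} (hP : b.Holds s → Runs P s T Φ) (hQ : ¬ b.Holds s → Runs Q s T Φ) :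
    Runs (Prog.ite b P Q) s (b.cost + T + 1) Φ := by
  by_cases hb : b.Holds s
  · obtain ⟨t, s', he, ht, hs⟩ := hP hb
    exact ⟨_, s', Exec.iteTrue hb he, by lia, hs⟩
  · obtain ⟨t, s', he, ht, hs⟩ := hQ hb
    exact ⟨_, s', Exec.iteFalse hb he, by lia, hs⟩

/-- The invariant `I` of the loop carries a bound for the number of remaining rounds. -/
lemma loop {b : Test} (I : ℕ → State → Prop) (m : ℕ) (hs : I m s)
    (h : ∀ m s', P.Frame s s' → I m s' → b.Holds s' → Runs P s' T fun s'' => ∃ m' < m, I m' s'')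
    (hΦ : ∀ m s', P.Frame s s' → I m s' → ¬ b.Holds s' → Φ s') :
    Runs (Prog.loop b P) s (m * (b.cost + T + 1) + b.cost + 1) Φ := by
  suffices ∀ m s', P.Frame s s' → I m s' →
      Runs (Prog.loop b P) s' (m * (b.cost + T + 1) + b.cost + 1) Φ from this m s (.refl _ _) hs
  intro m
  induction m using Nat.strong_induction_on with
  | _ m ih =>
    intro s' hf hI
    by_cases hb : b.Holds s'
    · obtain ⟨t, s₁, he, ht, m', hm, hI⟩ := h m s' hf hI hb
      obtain ⟨u, s₂, he', hu, hs₂⟩ := ih m' hm s₁ (hf.trans he.frame) hI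
      refine ⟨_, s₂, Exec.loopTrue hb he he', ?_, hs₂⟩
      obtain ⟨j, rfl⟩ : ∃ j, m = m' + 1 + j := ⟨m - (m' + 1), by lia⟩
      have : (m' + 1 + j) * (b.cost + T + 1) = m' * (b.cost + T + 1) + (b.cost + T + 1) +
        j * (b.cost + T + 1) := by ring
      lia
    · exact ⟨_, s', Exec.loopFalse hb, by lia, hΦ m s' hf hI hb⟩

end Runs

/-- The value of a scalar variable, kept in cell `0` of an index array. -/
abbrev ivar (A : ℕ) : IdxExpr := .get A (.lit 0)

/-- The value of a scalar variable, kept in cell `0` of a real array. -/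
abbrev rvar (A : ℕ) : RealExpr := .get A (.lit 0)

/-- `for i < N do P`, where `i` and `N` are scalar variables. -/
def forLoop (i N : ℕ) (P : Prog) : Prog :=
  .seq (.setIdx i (.lit 0) (.lit 0))
    (.loop (.idxLt (ivar i) (ivar N))
      (.seq P (.setIdx i (.lit 0) (.add (ivar i) (.lit 1)))))

/-- The body keeps `i` and `N`, and the invariant does not depend on `i` as a variable. -/
lemma Runs.forLoop {i N : ℕ} {P : Prog} {s : State} {T : ℕ} (I : ℕ → State → Prop) {n : ℕ}
    (hn : s.idx N 0 = n) (hN : N ∉ (forLoop i N P).idxWrites) (hi : i ∉ P.idxWrites)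
    (hI : ∀ k s v, I k s → I k (s.setIdx i 0 v)) (h0 : I 0 s)
    (h : ∀ k s', (RealRAM.forLoop i N P).Frame s s' → k < n → s'.idx i 0 = k → I k s' →
      Runs P s' T (I (k + 1))) :
    Runs (forLoop i N P) s (n * (T + 12) + 9) (I n) := by
  have hN' : N ∉ P.idxWrites ∧ N ≠ i := by
    simp only [RealRAM.forLoop, Prog.idxWrites, List.mem_append, not_or, List.mem_singleton] at hN
    exact hN.2
  have hF : ∀ s₁ s₂ : State,
      (Prog.seq P (.setIdx i (.lit 0) (.add (ivar i) (.lit 1)))).Frame s₁ s₂ →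
      (RealRAM.forLoop i N P).Frame s₁ s₂ := fun s₁ s₂ h =>
    h.mono (List.subset_append_right _ _) (List.subset_append_right _ _)
  have hF0 : ∀ v, (RealRAM.forLoop i N P).Frame s (s.setIdx i 0 v) := fun v =>
    (Exec.setIdx i (.lit 0) (.lit v) s).frame.mono (List.subset_append_left _ _)
      (List.subset_append_left _ _)
  -- Clearing the counter costs 3, each test 5 and each increment 6, with 1 more per evaluation of
  -- the loop.
  refine Runs.mono (T := 3 + (n * (5 + (T + 6) + 1) + 5 + 1)) (Φ := I n) ?_ ?_ fun _ _ h => h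
  · refine Runs.seq (Φ := (· = s.setIdx i 0 0)) (Runs.flat trivial le_rfl fun _ => rfl) ?_
    rintro _ - rfl
    refine Runs.loop (b := .idxLt (ivar i) (ivar N)) (T := T + 6)
      (fun m s' => m ≤ n ∧ s'.idx i 0 = n - m ∧ I (n - m) s') n ?_ ?_ ?_
    · refine ⟨le_rfl, by simp, ?_⟩
      rw [Nat.sub_self]
      exact hI _ _ _ h0
    · rintro m s' hf ⟨hm, h1, h3⟩ hb
      have hf' := (hF0 0).trans (hF _ _ hf)
      have h2 : s'.idx N 0 = n := by rw [hf'.1 N hN, hn]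
      have hlt : n - m < n := by simpa [Test.Holds, IdxExpr.eval, h1, h2] using hb
      refine Runs.seq (h (n - m) s' hf' hlt h1 h3) ?_
      intro s₁ h5 h4
      refine Runs.flat trivial le_rfl fun _ => ⟨m - 1, by lia, by lia, ?_, ?_⟩
      · simp [Prog.flat, IdxExpr.eval, h5.1 i hi, h1]; lia
      · have : n - (m - 1) = n - m + 1 := by lia
        rw [this]
        exact hI _ _ _ h4
    · rintro m s' hf ⟨hm, h1, h3⟩ hb
      have hf' := (hF0 0).trans (hF _ _ hf)
      have h2 : s'.idx N 0 = n := by rw [hf'.1 N hN, hn]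
      have : m = 0 := by
        have : ¬ n - m < n := by simpa only [Test.Holds, IdxExpr.eval, h1, h2] using hb
        lia
      simpa [this] using h3
  · have : n * (5 + (T + 6) + 1) = n * (T + 12) := by ring
    lia

end RealRAM

/-! ### The program

Index arrays: `0` the number of variables; `1` the output; `2` the variables by decreasing key;
`3`, `4` loop counters; `5` the current variable; `6` the number `G` of the last column; `7` the
variable to be observed last; `8` the address of the current row; `9`, `10` columns; `11` the next
columns; `12`, `13` the ends of the unfilled part of the output; `14` the number of columns.

Real arrays: `0` the accuracy; `1`, `2`, `3`, `4` the parameters; `5` the sum of the values of the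
single variables; `6` the number of variables; `7` the width of a column; `8` the grid; `9` the rows;
`10` the keys; `11` the values of the single variables; `12`, `13`, `14` the numbers `q`, `c` and
`1 - d` of the current variable; `15` the least cost found; `16` a temporary value. -/

namespace RealRAM

/-- The input is in the memory. -/
structure HasInput (Y : ℕ → ThreePointVar) (n : ℕ) (ε : ℝ) (s : State) : Prop where
  size : s.idx 0 0 = n
  accuracy : s.real 0 0 = ε
  a : ∀ i < n, s.real 1 i = (Y i).a
  m : ∀ i < n, s.real 2 i = (Y i).m
  p : ∀ i < n, s.real 3 i = (Y i).p
  q : ∀ i < n, s.real 4 i = (Y i).q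

/-- Programs which do not write to the input arrays keep the input. -/
lemma HasInput.of_frame {Y : ℕ → ThreePointVar} {n : ℕ} {ε : ℝ} {P : Prog} {s s' : State}
    (h : HasInput Y n ε s) (hf : P.Frame s s') (h0 : 0 ∉ P.idxWrites)
    (hr : ∀ A < 5, A ∉ P.realWrites) : HasInput Y n ε s' := by
  constructor
  · rw [hf.1 0 h0, h.size]
  · rw [hf.2 0 (hr 0 (by lia)), h.accuracy]
  · rw [hf.2 1 (hr 1 (by lia))]; exact h.a
  · rw [hf.2 2 (hr 2 (by lia))]; exact h.m
  · rw [hf.2 3 (hr 3 (by lia))]; exact h.p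
  · rw [hf.2 4 (hr 4 (by lia))]; exact h.q

/-- `q + p * m` for the variable `x`. -/
def upperMeanExpr (x : IdxExpr) : RealExpr := .add (.get 4 x) (.mul (.get 3 x) (.get 2 x))

/-- `p + q` for the variable `x`. -/
def upperProbExpr (x : IdxExpr) : RealExpr := .add (.get 3 x) (.get 4 x)

/-- The key by which the variables are sorted. -/
noncomputable def sortKey (X : ThreePointVar) : ℝ := X.upperMean / X.upperProb

/-! ### Keys and values of the single variables -/

def setupBody : Prog :=
  .seq (.setIdx 1 (ivar 3) (ivar 3)) <|
  .seq (.setIdx 2 (ivar 3) (ivar 3)) <|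
  .seq (.setReal 10 (ivar 3) (.div (upperMeanExpr (ivar 3)) (upperProbExpr (ivar 3)))) <|
  .seq (.ite (.realLt (.get 1 (ivar 3)) (.lit 0))
    (.setReal 11 (ivar 3) (upperMeanExpr (ivar 3)))
    (.setReal 11 (ivar 3) (.add (upperMeanExpr (ivar 3))
      (.mul (.sub (.lit 1) (upperProbExpr (ivar 3))) (.get 1 (ivar 3)))))) <|
  .seq (.setReal 5 (.lit 0) (.add (rvar 5) (.get 11 (ivar 3))))
  (.setReal 6 (.lit 0) (.add (rvar 6) (.lit 1)))

/-- The output is the identity; keys and values of the single variables are computed. -/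
def setupProg : Prog := forLoop 3 0 setupBody

lemma runs_setup {Y : ℕ → ThreePointVar} {n : ℕ} {ε : ℝ} {s : State} (hs : HasInput Y n ε s)
    (h5 : s.real 5 0 = 0) (h6 : s.real 6 0 = 0) :
    Runs setupProg s (n * 200 + 9) fun s' =>
      (∀ t < n, s'.idx 1 t = t ∧ s'.idx 2 t = t ∧ s'.real 10 t = sortKey (Y t) ∧
        s'.real 11 t = (Y t).step 0) ∧
      s'.real 5 0 = ∑ t ∈ Finset.range n, (Y t).step 0 ∧ s'.real 6 0 = n := by
  refine (Runs.forLoop (T := 188) (fun k s' =>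
      (∀ t < k, s'.idx 1 t = t ∧ s'.idx 2 t = t ∧ s'.real 10 t = sortKey (Y t) ∧
        s'.real 11 t = (Y t).step 0) ∧
      s'.real 5 0 = ∑ t ∈ Finset.range k, (Y t).step 0 ∧ s'.real 6 0 = k) hs.size (by decide)
    (by decide) ?_ ?_ ?_).mono (by lia) fun _ _ h => h
  · intro k s v h
    simpa using h
  · simp [h5, h6]
  · rintro k s' hf hk h3 ⟨h1, h2, h4⟩
    have hs' := hs.of_frame hf (by decide) (by decide)
    refine Runs.flat (by simp [setupBody, Prog.IsFlat]) (by decide) fun hf' => ?_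
    have e : ((Y k).step 0) = if (Y k).a < 0 then (Y k).upperMean else
        (Y k).upperMean + (1 - (Y k).upperProb) * (Y k).a := by
      rw [ThreePointVar.step_zero_eq]; split_ifs <;> simp
    have hm : (Y k).q + (Y k).p * (Y k).m = (Y k).upperMean := rfl
    have hp : (Y k).p + (Y k).q = (Y k).upperProb := rfl
    rw [Finset.sum_range_succ, e]
    by_cases ha : (Y k).a < 0
    · simp [setupBody, Prog.flat, IdxExpr.eval, RealExpr.eval, Test.Holds, h3, hs'.a k hk,
        hs'.m k hk, hs'.p k hk, hs'.q k hk, upperMeanExpr, upperProbExpr, hm, hp, ha, h2, h4]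
      intro t ht
      rcases eq_or_ne t k with rfl | hne
      · simp [e, ha, sortKey]
      · simpa [hne] using h1 t (by lia)
    · simp [setupBody, Prog.flat, IdxExpr.eval, RealExpr.eval, Test.Holds, h3, hs'.a k hk,
        hs'.m k hk, hs'.p k hk, hs'.q k hk, upperMeanExpr, upperProbExpr, hm, hp, ha, h2, h4]
      intro t ht
      rcases eq_or_ne t k with rfl | hne
      · simp [e, ha, sortKey]
      · simpa [hne] using h1 t (by lia)

/-! ### Sorting by decreasing key -/

def sortBody : Prog :=
  .ite (.conj (.idxLt (ivar 3) (ivar 4))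
      (.realLt (.get 10 (.get 2 (ivar 3))) (.get 10 (.get 2 (ivar 4)))))
    (.seq (.setIdx 5 (.lit 0) (.get 2 (ivar 3)))
      (.seq (.setIdx 2 (ivar 3) (.get 2 (ivar 4))) (.setIdx 2 (ivar 4) (ivar 5))))
    .skip

/-- Sorting by exchanges. -/
def sortProg : Prog := forLoop 3 0 (forLoop 4 0 sortBody)

/-- The sequence `x` runs through the numbers below `n`. -/
def IsArrangement (n : ℕ) (x : ℕ → ℕ) : Prop :=
  (∀ t < n, x t < n) ∧ ∀ t < n, ∀ u < n, x t = x u → t = u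

lemma IsArrangement.swap {n : ℕ} {x y : ℕ → ℕ} (h : IsArrangement n x) {i j : ℕ} (hi : i < n)
    (hj : j < n) (hy : ∀ t, y t = if t = j then x i else if t = i then x j else x t) :
    IsArrangement n y := by
  refine ⟨fun t ht => ?_, fun t ht u hu htu => ?_⟩
  · rw [hy]; split_ifs
    · exact h.1 i hi
    · exact h.1 j hj
    · exact h.1 t ht
  · rw [hy, hy] at htu
    split_ifs at htu with h1 h2 h3 h4 h5 h6 h7 h8 <;>
      first
        | lia
        | (have := h.2 _ (by assumption) _ (by assumption) htu; lia)

/-- Outer invariant: the positions below `i` dominate everything after them. Inner invariant: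
position `i` dominates the positions between `i` and `j`. The inner counter starts at 0, and the
test `i < j` makes its first rounds idle. -/
lemma runs_sort {n : ℕ} {s : State} (hn : s.idx 0 0 = n) (key : ℕ → ℝ)
    (hkey : ∀ t < n, s.real 10 t = key t) (hx : IsArrangement n (s.idx 2)) :
    Runs sortProg s (n * (n * 100 + 30) + 9) fun s' => IsArrangement n (s'.idx 2) ∧
      ∀ t u, t < u → u < n → key (s'.idx 2 u) ≤ key (s'.idx 2 t) := by
  refine (Runs.forLoop (T := n * 100 + 9) (fun i s' => IsArrangement n (s'.idx 2) ∧
      ∀ t u, t < i → t < u → u < n → key (s'.idx 2 u) ≤ key (s'.idx 2 t)) hn (by decide)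
      (by decide) ?_ ⟨hx, by simp⟩ ?_).mono (by lia)
      fun _ _ h => ⟨h.1, fun t u htu hu => h.2 t u (htu.trans hu) htu hu⟩
  · intro k s v h
    simpa using h
  · rintro i s₁ hf₁ hi h3 ⟨hx₁, hs₁⟩
    have hn₁ : s₁.idx 0 0 = n := by rw [hf₁.1 0 (by decide), hn]
    refine (Runs.forLoop (T := 80) (fun j s' => IsArrangement n (s'.idx 2) ∧
      (∀ t u, t < i → t < u → u < n → key (s'.idx 2 u) ≤ key (s'.idx 2 t)) ∧
      ∀ u, i < u → u < j → key (s'.idx 2 u) ≤ key (s'.idx 2 i)) hn₁ (by decide)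
      (by decide) ?_ ⟨hx₁, hs₁, by simp⟩ ?_).mono (by lia) fun s' _ h => ⟨h.1, ?_⟩
    · intro k s v h
      simpa using h
    · rintro j s₂ hf₂ hj h4 ⟨hx₂, hs₂, hs₃⟩
      have h3₂ : s₂.idx 3 0 = i := by rw [hf₂.1 3 (by decide), h3]
      have hk : ∀ t < n, s₂.real 10 (s₂.idx 2 t) = key (s₂.idx 2 t) := fun t ht => by
        rw [hf₂.2 10 (by decide), hf₁.2 10 (by decide), hkey _ (hx₂.1 t ht)]
      refine Runs.flat (by simp [sortBody, Prog.IsFlat]) (by decide) fun hf' => ?_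
      by_cases hb : i < j ∧ key (s₂.idx 2 i) < key (s₂.idx 2 j)
      · have hy : ∀ t, (sortBody.flat s₂).idx 2 t = if t = j then s₂.idx 2 i else
            if t = i then s₂.idx 2 j else s₂.idx 2 t := by
          intro t
          simp [sortBody, Prog.flat, IdxExpr.eval, RealExpr.eval, Test.Holds, h3₂, h4, hk i hi,
            hk j hj, hb]
        refine ⟨hx₂.swap hi hj hy, fun t u ht htu hu => ?_, fun u hiu hu => ?_⟩
        · rw [hy u, hy t, if_neg (by lia : ¬ t = j), if_neg (by lia : ¬ t = i)]
          split_ifs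
          · exact hs₂ t i ht ht hi
          · exact hs₂ t j ht (by lia) hj
          · exact hs₂ t u ht htu hu
        · rw [hy u, hy i, if_neg (by lia : ¬ i = j), if_pos rfl, if_neg (by lia : ¬ u = i)]
          split_ifs
          · exact hb.2.le
          · exact (hs₃ u hiu (by lia)).trans hb.2.le
      · have hy : (sortBody.flat s₂).idx 2 = s₂.idx 2 := by
          simp [sortBody, Prog.flat, IdxExpr.eval, RealExpr.eval, Test.Holds, h3₂, h4, hk i hi,
            hk j hj, if_neg hb]
        rw [hy]
        refine ⟨hx₂, hs₂, fun u hiu hu => ?_⟩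
        rcases (Nat.lt_succ_iff.mp hu).eq_or_lt with rfl | hu
        · exact not_lt.mp fun h => hb ⟨hiu, h⟩
        · exact hs₃ u hiu hu
    · intro t u ht htu hu
      rcases (Nat.lt_succ_iff.mp ht).eq_or_lt with rfl | ht
      · exact h.2.2 u htu hu
      · exact h.2.1 t u ht htu hu

/-! ### The grid of rounded values -/

def gridBody : Prog :=
  .seq (.setReal 8 (.add (ivar 6) (.lit 1)) (.add (.get 8 (ivar 6)) (rvar 7)))
    (.setIdx 6 (.lit 0) (.add (ivar 6) (.lit 1)))

/-- The multiples of the column width up to the sum of the values of the single variables. -/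
def gridProg : Prog :=
  .seq (.setReal 7 (.lit 0)
    (.div (.mul (rvar 0) (rvar 5)) (.mul (rvar 6) (.add (rvar 6) (.lit 1))))) <|
  .seq (.loop (.realLt (.get 8 (ivar 6)) (rvar 5)) gridBody)
  (.setIdx 14 (.lit 0) (.add (ivar 6) (.lit 1)))

/-- The machine has no floor function, so the grid grows by repeated addition until it reaches `S`.
The number `M` only bounds the rounds. If `S = 0`, then `δ = 0` and the loop stops at once with `G =
0`. -/
lemma runs_grid {n M : ℕ} {ε S δ : ℝ} {s : State} (hε : s.real 0 0 = ε) (hS : s.real 5 0 = S)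
    (hn : s.real 6 0 = n) (hG : s.idx 6 0 = 0) (h8 : s.real 8 0 = 0)
    (hδ : δ = ε * S / (n * (n + 1))) (hM : S ≤ M * δ) :
    Runs gridProg s (M * 40 + 40) fun s' => ∃ G ≤ M, s'.idx 6 0 = G ∧ s'.idx 14 0 = G + 1 ∧
      S ≤ G * δ ∧ ∀ g ≤ G, s'.real 8 g = g * δ := by
  refine (Runs.seq (T := 20) (U := M * 40 + 20) (Φ := (· = s.setReal 7 0 δ))
    (Runs.flat (by trivial) (by decide) fun _ => ?_) ?_).mono (by lia) fun _ _ h => h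
  · simp [Prog.flat, IdxExpr.eval, RealExpr.eval, hε, hS, hn, hδ]
  rintro _ - rfl
  refine (Runs.seq (T := M * 40 + 8) (U := 12) (Φ := fun s' => ∃ G ≤ M, s'.idx 6 0 = G ∧
      S ≤ G * δ ∧ ∀ g ≤ G, s'.real 8 g = g * δ) ?_ ?_).mono (by lia) fun _ _ h => h
  · refine (Runs.loop (T := 30) (fun m s' => ∃ G, G + m = M ∧ s'.idx 6 0 = G ∧
      ∀ g ≤ G, s'.real 8 g = g * δ) M ⟨0, by simp, ?_, ?_⟩ ?_ ?_).mono
        (by simp [Test.cost, RealExpr.cost, IdxExpr.cost]; lia) fun _ _ h => h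
    · simpa using hG
    · simpa using h8
    · rintro m s' hf ⟨G, hGm, h6, h8⟩ hb
      have h5 : s'.real 5 0 = S := by rw [hf.2 5 (by decide)]; simpa using hS
      have h7 : s'.real 7 0 = δ := by rw [hf.2 7 (by decide)]; simp
      have hlt : G * δ < S := by
        simpa [Test.Holds, IdxExpr.eval, RealExpr.eval, h5, h6, h8 G le_rfl] using hb
      have hm : 0 < m := by
        rcases Nat.eq_zero_or_pos m with rfl | hm
        · rw [add_zero] at hGm
          rw [hGm] at hlt
          exact absurd hM (not_le.mpr hlt)
        · exact hm
      refine Runs.flat (by simp [gridBody, Prog.IsFlat]) (by decide) fun _ =>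
        ⟨m - 1, by lia, G + 1, by lia, ?_, fun g hg => ?_⟩
      · simp [gridBody, Prog.flat, IdxExpr.eval, h6]
      · simp only [gridBody, Prog.flat, IdxExpr.eval, RealExpr.eval, h6, h7, State.setReal_real,
          State.setIdx_real, h8 G le_rfl, true_and]
        split_ifs with h
        · rw [h]; push_cast; ring
        · exact h8 g (by lia)
    · rintro m s' hf ⟨G, hGm, h6, h8⟩ hb
      have h5 : s'.real 5 0 = S := by rw [hf.2 5 (by decide)]; simpa using hS
      refine ⟨G, by lia, h6, ?_, h8⟩
      simpa [Test.Holds, IdxExpr.eval, RealExpr.eval, h5, h6, h8 G le_rfl] using hb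
  · rintro s' - ⟨G, hG, h6, hS, h8⟩
    refine Runs.flat (by trivial) (by decide) fun _ => ⟨G, hG, ?_, ?_, hS, ?_⟩
    · simpa [Prog.flat] using h6
    · simp [Prog.flat, IdxExpr.eval, h6]
    · simpa [Prog.flat] using h8

end RealRAM

/-! ### Filling one row with two pointers -/

lemma CellSpec.congr {G : ℕ} {δ q c d : ℝ} {W W' : ℕ → ℝ} {g : ℕ} {w : ℝ} {next : ℕ}
    (h : CellSpec G δ q c d W g w next) (hg : g ≤ G) (hW : ∀ g ≤ G, W' g = W g) :
    CellSpec G δ q c d W' g w next := by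
  obtain ⟨h, h1, h2, h3, h4, h5⟩ := h
  refine ⟨h, h1, h2, h3, h4, ?_⟩
  rwa [hW g hg, hW h h2]

namespace RealRAM

/-- Fill one cell of the new row. -/
def cellProg : Prog :=
  .seq (.setReal 16 (.lit 0)
    (.mul (.sub (.lit 1) (rvar 12)) (.get 9 (.add (ivar 8) (ivar 9))))) <|
  .seq (.ite (.realLt (.get 9 (.add (ivar 8) (ivar 10))) (rvar 16))
    (.seq (.setReal 9 (.add (.add (ivar 8) (ivar 14)) (ivar 9)) (.get 9 (.add (ivar 8) (ivar 10))))
      (.setIdx 11 (.add (ivar 8) (ivar 9)) (ivar 10)))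
    (.seq (.setReal 9 (.add (.add (ivar 8) (ivar 14)) (ivar 9)) (rvar 16))
      (.setIdx 11 (.add (ivar 8) (ivar 9)) (ivar 9))))
  (.setIdx 9 (.lit 0) (.add (ivar 9) (.lit 1)))

/-- Increase the second column if it is too small; otherwise fill the cell and increase the first
column. -/
def columnBody : Prog :=
  .ite (.idxLt (ivar 10) (ivar 9))
    (.setIdx 10 (.lit 0) (.add (ivar 10) (.lit 1)))
    (.ite (.conj (.idxLt (ivar 10) (ivar 6))
        (.neg (.realLt (.add (rvar 13) (.mul (rvar 14) (.get 8 (ivar 9))))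
          (.get 8 (.add (ivar 10) (.lit 1))))))
      (.setIdx 10 (.lit 0) (.add (ivar 10) (.lit 1)))
      cellProg)

/-- Compute one row from the preceding one. -/
def columnLoop : Prog := .loop (.idxLt (ivar 9) (ivar 14)) columnBody

/-- The rounded successor `h` does not decrease with `g`, so its pointer never moves back. Every
round advances `g` or `h`, and `2 * G + 1 - g - h` bounds the number of rounds left. -/
lemma runs_columns {b G : ℕ} {δ q c d : ℝ} {s : State} (hb : s.idx 8 0 = b) (hG : s.idx 6 0 = G)
    (hG1 : s.idx 14 0 = G + 1) (hgrid : ∀ g ≤ G, s.real 8 g = g * δ) (hq : s.real 12 0 = q)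
    (hc : s.real 13 0 = c) (hd : s.real 14 0 = 1 - d) (hδ : 0 ≤ δ) (hd1 : d ≤ 1)
    (hg0 : s.idx 9 0 = 0) (hh0 : s.idx 10 0 = 0) :
    Runs columnLoop s ((2 * G + 1) * 126 + 6) fun s' =>
      (∀ g ≤ G, CellSpec G δ q c d (fun g => s.real 9 (b + g)) g (s'.real 9 (b + (G + 1) + g))
        (s'.idx 11 (b + g))) ∧
      (∀ a < b + (G + 1), s'.real 9 a = s.real 9 a) ∧ ∀ a < b, s'.idx 11 a = s.idx 11 a := by
  -- This monotonicity keeps the bound on `h` valid when `g` advances.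
  have hstep : ∀ g : ℕ, c + (1 - d) * (g * δ) ≤ c + (1 - d) * ((g + 1 : ℕ) * δ) := fun g => by
    push_cast
    linarith [mul_nonneg (sub_nonneg.mpr hd1) hδ]
  refine (Runs.loop (T := 120) (fun m s' => ∃ g h, s'.idx 9 0 = g ∧ s'.idx 10 0 = h ∧
      g + h + m = 2 * G + 1 ∧ g ≤ G + 1 ∧ h ≤ G ∧ (h ≤ g ∨ (h : ℝ) * δ ≤ c + (1 - d) * (g * δ)) ∧
      (∀ g' < g, CellSpec G δ q c d (fun g => s.real 9 (b + g)) g'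
        (s'.real 9 (b + (G + 1) + g')) (s'.idx 11 (b + g'))) ∧
      (∀ a < b + (G + 1), s'.real 9 a = s.real 9 a) ∧ ∀ a < b, s'.idx 11 a = s.idx 11 a)
    (2 * G + 1) ⟨0, 0, hg0, hh0, by lia, by lia, by lia, by simp, by simp, by simp, by simp⟩
    ?_ ?_).mono (by simp [Test.cost, IdxExpr.cost]) fun _ _ h => h
  · rintro m s' hf ⟨g, h, h9, h10, hm, hg, hh, hgh, hcell, hW, hN⟩ htest
    have h8 : s'.idx 8 0 = b := by rw [hf.1 8 (by decide), hb]
    have h6 : s'.idx 6 0 = G := by rw [hf.1 6 (by decide), hG]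
    have h14 : s'.idx 14 0 = G + 1 := by rw [hf.1 14 (by decide), hG1]
    have hR : ∀ g ≤ G, s'.real 8 g = g * δ := by rw [hf.2 8 (by decide)]; exact hgrid
    have h12 : s'.real 12 0 = q := by rw [hf.2 12 (by decide), hq]
    have h13 : s'.real 13 0 = c := by rw [hf.2 13 (by decide), hc]
    have hr : s'.real 14 0 = 1 - d := by rw [hf.2 14 (by decide), hd]
    have hgG : g ≤ G := by
      have : g < G + 1 := by simpa only [Test.Holds, IdxExpr.eval, h9, h14] using htest
      lia
    refine Runs.flat (by simp [columnBody, cellProg, Prog.IsFlat]) (by decide) fun _ => ?_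
    by_cases h1 : h < g
    · have e : columnBody.flat s' = s'.setIdx 10 0 (h + 1) := by
        simp [columnBody, Prog.flat, Test.Holds, IdxExpr.eval, h9, h10, h1]
      rw [e]
      exact ⟨m - 1, by lia, g, h + 1, by simpa using h9, by simp, by lia, hg, by lia, by lia,
        by simpa using hcell, by simpa using hW, by simpa using hN⟩
    by_cases h2 : h < G ∧ ((h + 1 : ℕ) : ℝ) * δ ≤ c + (1 - d) * (g * δ)
    · have e : columnBody.flat s' = s'.setIdx 10 0 (h + 1) := by
        have := hR (h + 1) h2.1
        have h2' := h2.2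
        push_cast at this h2'
        simp [columnBody, Prog.flat, Test.Holds, IdxExpr.eval, RealExpr.eval, h9, h10, h6, h13,
          hr, hR g hgG, this, h2', h2.1]
      rw [e]
      exact ⟨m - 1, by lia, g, h + 1, by simpa using h9, by simp, by lia, hg, by lia, Or.inr h2.2,
        by simpa using hcell, by simpa using hW, by simpa using hN⟩
    -- Both tests failed: `h` is at least `g` and cannot be increased, so it is the truncated
    -- rounding required by `CellSpec`.
    have e : columnBody.flat s' = cellProg.flat s' := by
      have h2' : ¬ (h < G ∧ ¬ c + (1 - d) * (g * δ) < s'.real 8 (h + 1)) := by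
        rintro ⟨h3, h4⟩
        rw [hR _ h3] at h4
        exact h2 ⟨h3, not_lt.mp h4⟩
      simp only [columnBody, Prog.flat, Test.Holds, IdxExpr.eval, RealExpr.eval, h9, h10, h6, h13,
        hr, hR g hgG, if_neg h1, if_neg h2']
    rw [e]
    have hWg := hW (b + g) (by lia)
    have hWh := hW (b + h) (by lia)
    obtain ⟨hreal, hidx, h9', h10'⟩ : (∀ a, (cellProg.flat s').real 9 a =
        if a = b + (G + 1) + g then
          (if s.real 9 (b + h) < (1 - q) * s.real 9 (b + g) then s.real 9 (b + h) else
            (1 - q) * s.real 9 (b + g)) else s'.real 9 a) ∧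
        (∀ a, (cellProg.flat s').idx 11 a = if a = b + g then
          (if s.real 9 (b + h) < (1 - q) * s.real 9 (b + g) then h else g) else s'.idx 11 a) ∧
        (cellProg.flat s').idx 9 0 = g + 1 ∧ (cellProg.flat s').idx 10 0 = h := by
      by_cases h3 : s.real 9 (b + h) < (1 - q) * s.real 9 (b + g) <;>
        simp [cellProg, Prog.flat, Test.Holds, IdxExpr.eval, RealExpr.eval, h8, h9, h10, h12, h14,
          hWg, hWh, h3]
    refine ⟨m - 1, by lia, g + 1, h, h9', h10', by lia, by lia, hh, ?_, ?_, ?_, ?_⟩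
    · exact hgh.imp (fun h => by lia) fun h => h.trans (hstep g)
    · intro g' hg'
      rw [hreal, hidx]
      rcases eq_or_ne g' g with rfl | hne
      · rw [if_pos rfl, if_pos rfl]
        refine ⟨h, by lia, hh, hgh.imp (fun h => by lia) id, ?_, ?_⟩
        · by_contra! hcon
          exact h2 ⟨lt_of_le_of_ne hh hcon.1, by push_cast; exact hcon.2⟩
        · split_ifs with h3
          · exact Or.inr ⟨h3, rfl, rfl⟩
          · exact Or.inl ⟨not_lt.mp h3, rfl, rfl⟩
      · rw [if_neg (by lia), if_neg (by lia)]
        exact hcell g' (by lia)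
    · intro a ha
      rw [hreal, if_neg (by lia), hW a ha]
    · intro a ha
      rw [hidx, if_neg (by lia), hN a ha]
  · rintro m s' hf ⟨g, h, h9, h10, hm, hg, hh, hgh, hcell, hW, hN⟩ htest
    have h14 : s'.idx 14 0 = G + 1 := by rw [hf.1 14 (by decide), hG1]
    have hgG : ¬ g < G + 1 := by simpa only [Test.Holds, IdxExpr.eval, h9, h14] using htest
    exact ⟨fun g' hg' => hcell g' (by lia), hW, hN⟩

/-! ### Computing the whole table for a given last variable -/

def firstRowBody : Prog :=
  .ite (.realLt (.lit 1) (.get 8 (ivar 9)))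
    (.setReal 9 (ivar 9) (.lit 0))
    (.setReal 9 (ivar 9) (.sub (.lit 1) (.get 8 (ivar 9))))

/-- Load the parameters of the current variable, those of the last variable being zero. -/
def loadProg : Prog :=
  .seq (.setIdx 5 (.lit 0) (.get 2 (ivar 4))) <|
  .seq (.ite (.idxEq (ivar 5) (ivar 7))
    (.seq (.setReal 12 (.lit 0) (.lit 0)) <|
      .seq (.setReal 13 (.lit 0) (.lit 0)) (.setReal 14 (.lit 0) (.lit 1)))
    (.seq (.setReal 12 (.lit 0) (.get 4 (ivar 5))) <|
      .seq (.setReal 13 (.lit 0) (upperMeanExpr (ivar 5)))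
        (.setReal 14 (.lit 0) (.sub (.lit 1) (upperProbExpr (ivar 5)))))) <|
  .seq (.setIdx 9 (.lit 0) (.lit 0)) (.setIdx 10 (.lit 0) (.lit 0))

def rowBody : Prog :=
  .seq loadProg (.seq columnLoop (.setIdx 8 (.lit 0) (.add (ivar 8) (ivar 14))))

/-- Compute all rows. -/
def tableProg : Prog :=
  .seq (forLoop 9 14 firstRowBody) (.seq (.setIdx 8 (.lit 0) (.lit 0)) (forLoop 4 0 rowBody))

/-- The memory contains the rows `0, …, t` if the variable `k` is to be observed last. -/
def HasTable (Y : ℕ → ThreePointVar) (k t G : ℕ) (δ : ℝ) (x : ℕ → ℕ) (s : State) : Prop :=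
  IsTable t G δ (Function.update (fun x => (Y x).q) k 0)
    (Function.update (fun x => (Y x).upperMean) k 0)
    (Function.update (fun x => (Y x).upperProb) k 0) x
    (fun t g => s.real 9 (t * (G + 1) + g)) (fun t g => s.idx 11 (t * (G + 1) + g))

/-- Row `t` starts at address `t * (G + 1)`. Indices cannot be multiplied, so index array `8`
carries this address and is advanced by addition. -/
lemma runs_table {Y : ℕ → ThreePointVar} {n G k : ℕ} {ε δ : ℝ} {s : State}
    (hs : HasInput Y n ε s) (hx : ∀ t < n, s.idx 2 t < n) (hG : s.idx 6 0 = G)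
    (hG1 : s.idx 14 0 = G + 1) (hgrid : ∀ g ≤ G, s.real 8 g = g * δ) (hk : s.idx 7 0 = k)
    (hδ : 0 ≤ δ) :
    Runs tableProg s ((G + 1) * 50 + n * ((G + 1) * 252 + 150) + 30) fun s' =>
      HasTable Y k n G δ (s.idx 2) s' ∧ s'.idx 8 0 = n * (G + 1) := by
  refine (Runs.seq (T := (G + 1) * 50 + 9) (U := n * ((G + 1) * 252 + 150) + 15)
    (Φ := fun s' => ∀ g < G + 1, s'.real 9 g = max 0 (1 - g * δ)) ?_ ?_).mono (by lia)
    fun _ _ h => h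
  · refine (Runs.forLoop (T := 38) (fun j s' => ∀ g < j, s'.real 9 g = max 0 (1 - g * δ)) hG1
      (by decide) (by decide) ?_ (by simp) ?_).mono (by lia) fun _ _ h => h
    · intro k s v h; simpa using h
    · intro j s' hf hj h9 hI
      have hR : s'.real 8 j = j * δ := by rw [hf.2 8 (by decide), hgrid j (by lia)]
      refine Runs.flat (by simp [firstRowBody, Prog.IsFlat]) (by decide) fun _ => ?_
      intro g hg
      by_cases h1 : 1 < j * δ
      · simp [firstRowBody, Prog.flat, Test.Holds, IdxExpr.eval, RealExpr.eval, h9, hR, h1]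
        split_ifs with hgj
        · rw [hgj, max_eq_left (by linarith)]
        · exact hI g (by lia)
      · simp [firstRowBody, Prog.flat, Test.Holds, IdxExpr.eval, RealExpr.eval, h9, hR, h1]
        split_ifs with hgj
        · rw [hgj, max_eq_right (by linarith)]
        · exact hI g (by lia)
  intro s₁ hf₁ hW0
  refine (Runs.seq (T := 3) (U := n * ((G + 1) * 252 + 150) + 9) (Φ := (· = s₁.setIdx 8 0 0))
    (Runs.flat (by trivial) (by decide) fun _ => rfl) ?_).mono (by lia) fun _ _ h => h
  rintro _ hf₂ rfl
  have hs₂ : HasInput Y n ε (s₁.setIdx 8 0 0) :=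
    (hs.of_frame hf₁ (by decide) (by decide)).of_frame hf₂ (by decide) (by decide)
  refine (Runs.forLoop (T := (G + 1) * 252 + 130) (fun t s' => HasTable Y k t G δ (s.idx 2) s' ∧
    s'.idx 8 0 = t * (G + 1)) hs₂.size (by decide) (by decide) ?_ ⟨⟨?_, ?_⟩, ?_⟩ ?_).mono
      (Nat.add_le_add_right (Nat.mul_le_mul_left n (by lia)) 9) fun _ _ h => h
  · intro k s v h; simpa [HasTable] using h
  · intro g hg
    simpa using hW0 g (by lia)
  · intro t ht; lia
  · simp
  intro t s₃ hf₃ ht h4 ⟨hT, h8⟩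
  have hs₃ : HasInput Y n ε s₃ := hs₂.of_frame hf₃ (by decide) (by decide)
  have h2 : s₃.idx 2 = s.idx 2 := by
    rw [hf₃.1 2 (by decide), hf₂.1 2 (by decide), hf₁.1 2 (by decide)]
  have h7 : s₃.idx 7 0 = k := by
    rw [hf₃.1 7 (by decide), hf₂.1 7 (by decide), hf₁.1 7 (by decide), hk]
  have h6 : s₃.idx 6 0 = G := by
    rw [hf₃.1 6 (by decide), hf₂.1 6 (by decide), hf₁.1 6 (by decide), hG]
  have h14 : s₃.idx 14 0 = G + 1 := by
    rw [hf₃.1 14 (by decide), hf₂.1 14 (by decide), hf₁.1 14 (by decide), hG1]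
  have hR : ∀ g ≤ G, s₃.real 8 g = g * δ := by
    rw [hf₃.2 8 (by decide), hf₂.2 8 (by decide), hf₁.2 8 (by decide)]; exact hgrid
  have hxt := hx t ht
  refine (Runs.seq (T := 110) (U := (G + 1) * 252 + 14) (Φ := fun s' =>
    s'.real 12 0 = Function.update (fun x => (Y x).q) k 0 (s.idx 2 t) ∧
    s'.real 13 0 = Function.update (fun x => (Y x).upperMean) k 0 (s.idx 2 t) ∧
    s'.real 14 0 = 1 - Function.update (fun x => (Y x).upperProb) k 0 (s.idx 2 t) ∧
    s'.idx 9 0 = 0 ∧ s'.idx 10 0 = 0)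
    (Runs.flat (by simp [loadProg, Prog.IsFlat]) (by decide) fun _ => ?_) ?_).mono (by lia)
    fun _ _ h => h
  · by_cases hxk : s.idx 2 t = k
    · simp [loadProg, Prog.flat, Test.Holds, IdxExpr.eval, RealExpr.eval, h4, h7, h2, hxk]
    · simp [loadProg, Prog.flat, Test.Holds, IdxExpr.eval, RealExpr.eval, h4, h7, h2, hxk,
        upperMeanExpr, upperProbExpr, hs₃.m _ hxt, hs₃.p _ hxt, hs₃.q _ hxt,
        ThreePointVar.upperMean, ThreePointVar.upperProb]
  rintro s₄ hf₄ ⟨h12, h13, hr14, h9, h10⟩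
  have h8₄ : s₄.idx 8 0 = t * (G + 1) := by rw [hf₄.1 8 (by decide), h8]
  have h6₄ : s₄.idx 6 0 = G := by rw [hf₄.1 6 (by decide), h6]
  have h14₄ : s₄.idx 14 0 = G + 1 := by rw [hf₄.1 14 (by decide), h14]
  have hR₄ : ∀ g ≤ G, s₄.real 8 g = g * δ := by rw [hf₄.2 8 (by decide)]; exact hR
  have hd1 : Function.update (fun x => (Y x).upperProb) k 0 (s.idx 2 t) ≤ 1 := by
    rw [Function.update_apply]
    split_ifs
    · exact zero_le_one
    · exact (Y _).upperProb_le_one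
  refine (Runs.seq (U := 8)
    (runs_columns h8₄ h6₄ h14₄ hR₄ h12 h13 hr14 hδ hd1 h9 h10) ?_).mono (by lia) fun _ _ h => h
  rintro s₅ hf₅ ⟨hcell, hW, hN⟩
  -- The new row is written behind rows `0, …, t`, and its `next` entries behind those of the
  -- earlier rows, so the old table survives.
  have hW' : ∀ a < t * (G + 1) + (G + 1), s₅.real 9 a = s₃.real 9 a := fun a ha => by
    rw [hW a ha, hf₄.2 9 (by decide)]
  have hN' : ∀ a < t * (G + 1), s₅.idx 11 a = s₃.idx 11 a := fun a ha => by
    rw [hN a ha, hf₄.1 11 (by decide)]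
  refine Runs.flat (by trivial) (by decide) fun _ => ⟨⟨?_, ?_⟩, ?_⟩
  · intro g hg
    have := hT.init g hg
    simp only [Prog.flat, State.setIdx_real]
    rw [hW' _ (by lia), this]
  · intro u hu g hg
    simp only [Prog.flat, State.setIdx_real]
    rw [State.setIdx_idx_of_ne _ (by decide)]
    rcases (Nat.lt_succ_iff.mp hu).eq_or_lt with rfl | hut
    · have := (hcell g hg).congr hg (W' := fun g => s₅.real 9 (u * (G + 1) + g))
        fun g hg => hW _ (by lia)
      rwa [add_mul, one_mul]
    · have h1 : (u + 1) * (G + 1) ≤ t * (G + 1) := Nat.mul_le_mul_right _ hut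
      have h2 : (u + 1) * (G + 1) = u * (G + 1) + (G + 1) := by ring
      have := (hT.cell u hut g hg).congr hg (W' := fun g => s₅.real 9 (u * (G + 1) + g))
        fun g hg => hW' _ (by lia)
      rwa [hW' _ (by lia), hN' _ (by lia)]
  · simp only [Prog.flat, IdxExpr.eval, State.setIdx_idx, and_self, if_true]
    rw [hf₅.1 8 (by decide), hf₅.1 14 (by decide), h8₄, h14₄]
    ring

end RealRAM

/-! ### Starting column and reading off an ordering -/

namespace RealRAM

/-- Round the value of the last variable down to a column. -/
def startProg : Prog :=
  .seq (.setIdx 9 (.lit 0) (.lit 0))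
    (.loop (.conj (.idxLt (ivar 9) (ivar 6))
        (.neg (.realLt (.get 11 (ivar 7)) (.get 8 (.add (ivar 9) (.lit 1))))))
      (.setIdx 9 (.lit 0) (.add (ivar 9) (.lit 1))))

/-- The lower estimate serves the traced ordering; the upper one lets `IsTable.le_optCost` start
with `s = 1`. -/
lemma runs_start {G k : ℕ} {δ v : ℝ} {s : State} (hG : s.idx 6 0 = G) (hk : s.idx 7 0 = k)
    (hgrid : ∀ g ≤ G, s.real 8 g = g * δ) (hv : s.real 11 k = v) (hv0 : 0 ≤ v)
    (hvG : v ≤ G * δ) (hδ : 0 ≤ δ) :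
    Runs startProg s (G * 50 + 50) fun s' => ∃ g ≤ G, s'.idx 9 0 = g ∧ g * δ ≤ v ∧
      v ≤ (g + 1) * δ := by
  refine (Runs.seq (T := 3) (U := G * 50 + 40) (Φ := (· = s.setIdx 9 0 0))
    (Runs.flat (by trivial) (by decide) fun _ => rfl) ?_).mono (by lia) fun _ _ h => h
  rintro _ hf₁ rfl
  refine (Runs.loop (T := 7) (fun m s' => ∃ g, g + m = G ∧ s'.idx 9 0 = g ∧ g * δ ≤ v) G
    ⟨0, by simp, by simp, by simpa using hv0⟩ ?_ ?_).mono
      (by simp [Test.cost, RealExpr.cost, IdxExpr.cost]; lia) fun _ _ h => h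
  · rintro m s' hf ⟨g, hgm, h9, -⟩ hb
    have h6 : s'.idx 6 0 = G := by rw [hf.1 6 (by decide), hf₁.1 6 (by decide), hG]
    have h7 : s'.idx 7 0 = k := by rw [hf.1 7 (by decide), hf₁.1 7 (by decide), hk]
    have h11 : s'.real 11 k = v := by rw [hf.2 11 (by decide), hf₁.2 11 (by decide), hv]
    have hb' : g < G ∧ ¬ v < s'.real 8 (g + 1) := by
      simpa only [Test.Holds, IdxExpr.eval, RealExpr.eval, h6, h7, h9, h11] using hb
    have h8 : s'.real 8 (g + 1) = (g + 1 : ℕ) * δ := by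
      rw [hf.2 8 (by decide), hf₁.2 8 (by decide), hgrid _ (by lia)]
    rw [h8] at hb'
    exact Runs.flat (by trivial) (by decide) fun _ => ⟨m - 1, by lia, g + 1, by lia,
      by simp [Prog.flat, IdxExpr.eval, h9], not_lt.mp hb'.2⟩
  · rintro m s' hf ⟨g, hgm, h9, hgv⟩ hb
    have h6 : s'.idx 6 0 = G := by rw [hf.1 6 (by decide), hf₁.1 6 (by decide), hG]
    have h7 : s'.idx 7 0 = k := by rw [hf.1 7 (by decide), hf₁.1 7 (by decide), hk]
    have h11 : s'.real 11 k = v := by rw [hf.2 11 (by decide), hf₁.2 11 (by decide), hv]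
    have hb' : ¬ (g < G ∧ ¬ v < s'.real 8 (g + 1)) := by
      simpa only [Test.Holds, IdxExpr.eval, RealExpr.eval, h6, h7, h9, h11] using hb
    refine ⟨g, by lia, h9, hgv, ?_⟩
    by_cases hgG : g < G
    · have h8 : s'.real 8 (g + 1) = (g + 1 : ℕ) * δ := by
        rw [hf.2 8 (by decide), hf₁.2 8 (by decide), hgrid _ (by lia)]
      rw [h8] at hb'
      push_cast at hb'
      exact (not_not.mp fun h => hb' ⟨hgG, h⟩).le
    · have : g = G := by lia
      subst this
      linarith

/-- Place one variable: at the front if it is accepted at its largest value only, and at the back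
otherwise. -/
def traceBody : Prog :=
  .seq (.setIdx 5 (.lit 0) (.get 2 (.sub (ivar 0) (.add (ivar 4) (.lit 1))))) <|
  .seq (.setIdx 8 (.lit 0) (.sub (ivar 8) (ivar 14))) <|
  .seq (.ite (.idxEq (ivar 5) (ivar 7)) .skip
    (.ite (.idxEq (.get 11 (.add (ivar 8) (ivar 9))) (ivar 9))
      (.seq (.setIdx 1 (ivar 12) (ivar 5)) (.setIdx 12 (.lit 0) (.add (ivar 12) (.lit 1))))
      (.seq (.setIdx 13 (.lit 0) (.sub (ivar 13) (.lit 1))) (.setIdx 1 (ivar 13) (ivar 5)))))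
  (.setIdx 9 (.lit 0) (.get 11 (.add (ivar 8) (ivar 9))))

/-- Output the ordering described by the rows. -/
def traceProg : Prog :=
  .seq (.seq (.setIdx 12 (.lit 0) (.lit 0))
    (.seq (.setIdx 13 (.lit 0) (.sub (ivar 0) (.lit 1))) (.setIdx 1 (ivar 13) (ivar 7))))
  (forLoop 4 0 traceBody)

/-- The rows are read from `n` down to 0, hence by increasing key, so each new member of `l₂`
belongs before the earlier ones. Along the way `missProb l₁` times the current entry stays equal to
the initial entry, and the column stays below the true value of the chain over `l₂`. At row 0 the
entry is at least `1 - g * δ`, which bounds the true loss. -/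
lemma runs_trace {Y : ℕ → ThreePointVar} {n G k g₀ : ℕ} {δ v : ℝ} {x : ℕ → ℕ} {s : State}
    (hT : HasTable Y k n G δ x s) (hn : s.idx 0 0 = n) (hx : s.idx 2 = x)
    (hG1 : s.idx 14 0 = G + 1) (hk : s.idx 7 0 = k) (h8 : s.idx 8 0 = n * (G + 1))
    (h9 : s.idx 9 0 = g₀) (hg₀ : g₀ ≤ G) (hv : g₀ * δ ≤ v)
    (hF : (k :: (revPrefix x n).filter (· != k)).Perm (List.range n)) :
    Runs traceProg s (n * 100 + 40) fun s' => ∃ l₁ l₂ : List ℕ,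
      (l₁ ++ (l₂ ++ [k])).Perm (List.range n) ∧
      (∀ i a, (l₁ ++ (l₂ ++ [k]))[i]? = some a → s'.idx 1 i = a) ∧
      missProb (fun x => (Y x).q) l₁ *
        (1 - affineChain (fun x => (Y x).upperMean) (fun x => (Y x).upperProb) l₂ v) ≤
        s.real 9 (n * (G + 1) + g₀) := by
  have hlen : ((revPrefix x n).filter (· != k)).length + 1 = n := by
    simpa using hF.length_eq
  have hkF : k ∉ (revPrefix x n).filter (· != k) := by simp
  set F := (revPrefix x n).filter (· != k) with hFdef
  unfold HasTable at hT
  set q := Function.update (fun x => (Y x).q) k 0 with hq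
  set c := Function.update (fun x => (Y x).upperMean) k 0 with hc
  set d := Function.update (fun x => (Y x).upperProb) k 0 with hd
  have hq0 : ∀ y, 0 ≤ q y := fun y => by
    rw [hq, Function.update_apply]; split_ifs; exacts [le_rfl, (Y y).q_nonneg]
  have hq1 : ∀ y, q y ≤ 1 := fun y => by
    rw [hq, Function.update_apply]; split_ifs; exacts [zero_le_one, (Y y).q_le_one]
  have hd1 : ∀ y, d y ≤ 1 := fun y => by
    rw [hd, Function.update_apply]; split_ifs; exacts [zero_le_one, (Y y).upperProb_le_one]
  refine (Runs.seq (T := 20) (U := n * 100 + 9) (Φ := fun s' => s'.idx 12 0 = 0 ∧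
    s'.idx 13 0 = n - 1 ∧ s'.idx 1 (n - 1) = k)
    (Runs.flat (by simp [Prog.IsFlat]) (by decide) fun _ => ?_) ?_).mono (by lia) fun _ _ h => h
  · simp [Prog.flat, IdxExpr.eval, hn, hk]
  rintro s₁ hf₁ ⟨h12, h13, h1⟩
  -- The free output cells run from `l₁.length` up to, but excluding, the number in index array
  -- `13`; the `+ 1` accounts for `k` in the last cell.
  refine (Runs.forLoop (T := 88) (fun j s' => ∃ (l₁ l₂ : List ℕ) (g : ℕ),
      s'.idx 8 0 = (n - j) * (G + 1) ∧ s'.idx 9 0 = g ∧ g ≤ G ∧ s'.idx 12 0 = l₁.length ∧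
      s'.idx 13 0 + l₂.length + 1 = n ∧
      ((l₁ ++ l₂) ++ (revPrefix x (n - j)).filter (· != k)).Perm F ∧
      (∀ i a, l₁[i]? = some a → s'.idx 1 i = a) ∧
      (∀ i a, (l₂ ++ [k])[i]? = some a → s'.idx 1 (s'.idx 13 0 + i) = a) ∧
      missProb q l₁ * s.real 9 ((n - j) * (G + 1) + g) = s.real 9 (n * (G + 1) + g₀) ∧
      g * δ ≤ affineChain c d l₂ v) (by rw [hf₁.1 0 (by decide), hn]) (by decide) (by decide) ?_
    ⟨[], [], g₀, ?_⟩ ?_).mono (by lia) ?_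
  · intro k s v h; simpa using h
  · refine ⟨by rw [hf₁.1 8 (by decide), h8, Nat.sub_zero], by rw [hf₁.1 9 (by decide), h9], hg₀,
      by simpa using h12, by simp [h13]; lia, by simp [hFdef], by simp, ?_, by simp,
      by simpa using hv⟩
    intro i a hi
    rcases i with _ | i
    · simp at hi
      rw [h13, add_zero, h1, hi]
    · simp at hi
  · rintro j s' hf hj h4 ⟨l₁, l₂, g, e8, e9, hg, e12, e13, hp, ho₁, ho₂, hm, hch⟩
    obtain ⟨t, ht⟩ : ∃ t, n - j = t + 1 := ⟨n - j - 1, by lia⟩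
    have ht' : n - (j + 1) = t := by lia
    rw [ht] at e8 hp hm
    rw [ht']
    have e0 : s'.idx 0 0 = n := by rw [hf.1 0 (by decide), hf₁.1 0 (by decide), hn]
    have e2 : s'.idx 2 = x := by rw [hf.1 2 (by decide), hf₁.1 2 (by decide), hx]
    have e7 : s'.idx 7 0 = k := by rw [hf.1 7 (by decide), hf₁.1 7 (by decide), hk]
    have e14 : s'.idx 14 0 = G + 1 := by rw [hf.1 14 (by decide), hf₁.1 14 (by decide), hG1]
    have e11 : s'.idx 11 = s.idx 11 := by rw [hf.1 11 (by decide), hf₁.1 11 (by decide)]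
    have eb : (t + 1) * (G + 1) - (G + 1) = t * (G + 1) := by
      rw [add_mul, one_mul, Nat.add_sub_cancel]
    have hnext := hT.next_spec hq0 hq1 (by lia : t < n) hg
    set y := s.idx 11 (t * (G + 1) + g) with hy
    refine Runs.flat (by simp [traceBody, Prog.IsFlat]) (by decide) fun _ => ?_
    -- The parameters of `k` are zero in the table, so its row passes the entry on unchanged, and
    -- `k` has already been placed.
    by_cases hxk : x t = k
    · obtain ⟨f8, f9, f12, f13, f1⟩ : (traceBody.flat s').idx 8 0 = t * (G + 1) ∧
          (traceBody.flat s').idx 9 0 = y ∧ (traceBody.flat s').idx 12 0 = s'.idx 12 0 ∧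
          (traceBody.flat s').idx 13 0 = s'.idx 13 0 ∧
          ∀ i, (traceBody.flat s').idx 1 i = s'.idx 1 i := by
        simp [traceBody, Prog.flat, Test.Holds, IdxExpr.eval, h4, e0, e2, e7, e8, e9, e11, e14,
          eb, ht', hxk, hy]
      rw [f8, f9, f12, f13]
      have hqk : q (x t) = 0 := by rw [hxk, hq, Function.update_self]
      have hck : c (x t) = 0 := by rw [hxk, hc, Function.update_self]
      have hdk : d (x t) = 0 := by rw [hxk, hd, Function.update_self]
      refine ⟨l₁, l₂, y, rfl, rfl, ?_, e12, e13, ?_, ?_, ?_, ?_, ?_⟩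
      · rcases hnext with h | h
        · exact h.1.le.trans hg
        · exact h.2.1
      · simpa [revPrefix, List.filter_cons, hxk] using hp
      · intro i a hi; rw [f1]; exact ho₁ i a hi
      · intro i a hi; rw [f1]; exact ho₂ i a hi
      · rw [← hm]
        rcases hnext with h | h
        · rw [h.2, hqk, h.1, sub_zero, one_mul]
        · rw [h.2.2.2]
      · refine le_trans ?_ hch
        rcases hnext with h | h
        · rw [h.1]
        · have := h.2.2.1
          rwa [hck, hdk, zero_add, sub_zero, one_mul] at this
    · have hperm : ((l₁ ++ l₂) ++ x t :: (revPrefix x t).filter (· != k)).Perm F := by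
        simpa [revPrefix, List.filter_cons, hxk] using hp
      have hl := hperm.length_eq
      simp only [List.length_append, List.length_cons] at hl
      -- By `next_spec` the column is unchanged exactly when the row chose `l₁`.
      by_cases hyg : y = g
      · obtain ⟨f8, f9, f12, f13, f1⟩ : (traceBody.flat s').idx 8 0 = t * (G + 1) ∧
            (traceBody.flat s').idx 9 0 = y ∧ (traceBody.flat s').idx 12 0 = l₁.length + 1 ∧
            (traceBody.flat s').idx 13 0 = s'.idx 13 0 ∧
            ∀ i, (traceBody.flat s').idx 1 i = if i = l₁.length then x t else s'.idx 1 i := by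
          simp [traceBody, Prog.flat, Test.Holds, IdxExpr.eval, h4, e0, e2, e7, e8, e9, e11, e14,
            e12, eb, ht', hxk, ← hy, hyg]
        rw [f8, f9, f12, f13]
        have hA := hnext.resolve_right fun h => by lia
        refine ⟨l₁ ++ [x t], l₂, y, rfl, rfl, hyg.le.trans hg, by simp, e13, ?_, ?_, ?_, ?_, ?_⟩
        · refine List.Perm.trans ?_ hperm
          simp only [List.append_assoc, List.singleton_append]
          exact List.Perm.append_left _ (List.perm_middle.symm)
        · intro i a hi
          rw [f1]
          split_ifs with h
          · rw [h] at hi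
            simpa using hi
          · refine ho₁ i a ?_
            have hi' := (List.getElem?_eq_some_iff.mp hi).1
            rw [List.length_append, List.length_singleton] at hi'
            rwa [List.getElem?_append_left (by lia)] at hi
        · intro i a hi
          rw [f1, if_neg (by lia)]
          exact ho₂ i a hi
        · rw [← hm, missProb_perm q (List.perm_append_singleton _ _), missProb_cons, hA.2, hyg]
          ring
        · rwa [hyg]
      · obtain ⟨f8, f9, f12, f13, f1⟩ : (traceBody.flat s').idx 8 0 = t * (G + 1) ∧
            (traceBody.flat s').idx 9 0 = y ∧ (traceBody.flat s').idx 12 0 = s'.idx 12 0 ∧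
            (traceBody.flat s').idx 13 0 = s'.idx 13 0 - 1 ∧
            ∀ i, (traceBody.flat s').idx 1 i =
              if i = s'.idx 13 0 - 1 then x t else s'.idx 1 i := by
          simp [traceBody, Prog.flat, Test.Holds, IdxExpr.eval, h4, e0, e2, e7, e8, e9, e11, e14,
            eb, ht', hxk, ← hy, hyg]
        rw [f8, f9, f12, f13]
        have hB := hnext.resolve_left fun h => hyg h.1
        refine ⟨l₁, x t :: l₂, y, rfl, rfl, hB.2.1, e12, by simp; lia, ?_, ?_, ?_, ?_, ?_⟩
        · refine List.Perm.trans ?_ hperm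
          simp only [List.append_assoc, List.cons_append]
          refine List.Perm.append_left _ ?_
          exact List.perm_middle.symm
        · intro i a hi
          have hi' := (List.getElem?_eq_some_iff.mp hi).1
          rw [f1, if_neg (by lia)]
          exact ho₁ i a hi
        · intro i a hi
          rcases i with _ | i
          · rw [f1, if_pos (by lia)]
            simpa using hi
          · rw [f1, if_neg (by lia)]
            have := ho₂ i a (by simpa using hi)
            rwa [show s'.idx 13 0 - 1 + (i + 1) = s'.idx 13 0 + i by lia]
        · rw [← hm, hB.2.2.2]
        · rw [affineChain_cons]
          refine hB.2.2.1.trans ?_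
          linarith [mul_le_mul_of_nonneg_left hch (sub_nonneg.mpr (hd1 (x t)))]
  · rintro s' hf ⟨l₁, l₂, g, e8, e9, hg, e12, e13, hp, ho₁, ho₂, hm, hch⟩
    rw [Nat.sub_self] at hp hm
    simp only [revPrefix, List.filter_nil, List.append_nil] at hp
    have hl := hp.length_eq
    rw [List.length_append] at hl
    have hk' : k ∉ l₁ ++ l₂ := fun h => hkF (hp.subset h)
    rw [List.mem_append, not_or] at hk'
    refine ⟨l₁, l₂, ?_, ?_, ?_⟩
    · rw [← List.append_assoc]
      exact (List.perm_append_singleton _ _).trans ((hp.cons k).trans hF)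
    · intro i a hi
      rcases lt_or_ge i l₁.length with h | h
      · rw [List.getElem?_append_left h] at hi
        exact ho₁ i a hi
      · rw [List.getElem?_append_right h] at hi
        have := ho₂ _ a hi
        rwa [show s'.idx 13 0 + (i - l₁.length) = i by lia] at this
    · rw [← hm, ← missProb_update _ k 0 l₁ hk'.1, ← affineChain_update _ _ k 0 0 l₂ hk'.2]
      refine mul_le_mul_of_nonneg_left ?_ (missProb_nonneg hq1 _)
      have h0 := hT.init g hg
      rw [h0]
      exact le_trans (by linarith) (le_max_right _ _)

end RealRAM

/-! ### Arrangements as permutations of a range -/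

lemma perm_range_of_nodup {l : List ℕ} {n : ℕ} (hl : l.Nodup) (hlen : l.length = n)
    (hmem : ∀ a ∈ l, a < n) : l.Perm (List.range n) :=
  (hl.subperm fun a ha => List.mem_range.mpr (hmem a ha)).perm_of_length_le (by simp [hlen])

lemma mem_revPrefix {x : ℕ → ℕ} {t y : ℕ} : y ∈ revPrefix x t ↔ ∃ u < t, x u = y := by
  simp [revPrefix_eq]

lemma length_revPrefix (x : ℕ → ℕ) (t : ℕ) : (revPrefix x t).length = t := by
  simp [revPrefix_eq]

lemma pairwise_revPrefix {x : ℕ → ℕ} {R : ℕ → ℕ → Prop} {t : ℕ}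
    (h : ∀ u v, u < v → v < t → R (x v) (x u)) : (revPrefix x t).Pairwise R := by
  induction t with
  | zero => exact List.Pairwise.nil
  | succ t ih =>
    refine List.Pairwise.cons (fun y hy => ?_) (ih fun u v huv hv => h u v huv (by lia))
    obtain ⟨u, hu, rfl⟩ := mem_revPrefix.mp hy
    exact h u t hu (by lia)

lemma nodup_revPrefix {n : ℕ} {x : ℕ → ℕ} (hx : RealRAM.IsArrangement n x) :
    (revPrefix x n).Nodup :=
  pairwise_revPrefix fun u v huv hv h => huv.ne' (hx.2 v hv u (huv.trans hv) h)

lemma revPrefix_perm_range {n : ℕ} {x : ℕ → ℕ} (hx : RealRAM.IsArrangement n x) :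
    (revPrefix x n).Perm (List.range n) := by
  refine perm_range_of_nodup (nodup_revPrefix hx) (length_revPrefix x n) fun a ha => ?_
  obtain ⟨u, hu, rfl⟩ := mem_revPrefix.mp ha
  exact hx.1 u hu

lemma cons_filter_perm_range {n k : ℕ} {x : ℕ → ℕ} (hx : RealRAM.IsArrangement n x) (hk : k < n) :
    (k :: (revPrefix x n).filter (· != k)).Perm (List.range n) := by
  have hp := revPrefix_perm_range hx
  rw [← (nodup_revPrefix hx).erase_eq_filter]
  exact (List.perm_cons_erase (hp.symm.subset (List.mem_range.mpr hk))).symm.trans hp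

lemma sum_arrangement_le {n : ℕ} {x : ℕ → ℕ} (hx : RealRAM.IsArrangement n x) {f : ℕ → ℝ}
    (hf : ∀ y, 0 ≤ f y) : ∑ t ∈ Finset.range n, f (x t) ≤ ∑ y ∈ Finset.range n, f y := by
  rw [← Finset.sum_image (f := f) (g := x) (s := Finset.range n) fun t ht u hu h =>
    hx.2 t (by simpa using ht) u (by simpa using hu) h]
  refine Finset.sum_le_sum_of_subset_of_nonneg (fun y hy => ?_) fun y _ _ => hf y
  obtain ⟨t, ht, rfl⟩ := Finset.mem_image.mp hy
  exact Finset.mem_range.mpr (hx.1 t (Finset.mem_range.mp ht))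

/-! ### The search over the last variable -/

namespace RealRAM

/-- The output is an ordering of value at least `1 - w`. -/
def Achieves (Y : ℕ → ThreePointVar) (n : ℕ) (w : ℝ) (s : State) : Prop :=
  ∃ l : List ℕ, l.Perm (List.range n) ∧ (∀ i a, l[i]? = some a → s.idx 1 i = a) ∧
    1 - w ≤ stoppingValue (l.map Y)

/-- The best ordering found with a given last variable replaces the output if it is better. -/
def candidateProg : Prog :=
  .seq tableProg <| .seq startProg <|
    .ite (.realLt (.get 9 (.add (ivar 8) (ivar 9))) (rvar 15))
      (.seq (.setReal 15 (.lit 0) (.get 9 (.add (ivar 8) (ivar 9)))) traceProg)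
      .skip

/-- The state after sorting and computing the grid. -/
structure IsReady (Y : ℕ → ThreePointVar) (n G : ℕ) (ε δ : ℝ) (x : ℕ → ℕ) (s : State) :
    Prop where
  input : HasInput Y n ε s
  order : s.idx 2 = x
  last : s.idx 6 0 = G
  columns : s.idx 14 0 = G + 1
  grid : ∀ g ≤ G, s.real 8 g = g * δ
  single : ∀ t < n, s.real 11 t = (Y t).step 0

/-- The entry `w` at the starting column plays two roles: it is within `(n + 1) * δ` of the optimum
for `k`, and the ordering traced from it has value at least `1 - w`. -/
lemma runs_candidate {Y : ℕ → ThreePointVar} {n G k : ℕ} {ε δ : ℝ} {x : ℕ → ℕ} {s : State}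
    (hs : IsReady Y n G ε δ x s) (hx : IsArrangement n x) (hδ : 0 ≤ δ)
    (hG : ∑ y ∈ Finset.range n, (Y y).step 0 ≤ G * δ) (hk : k < n) (h7 : s.idx 7 0 = k) :
    Runs candidateProg s ((G + 1) * 100 + n * ((G + 1) * 252 + 250) + 150) fun s' =>
      ∃ w ≤ lastCost Y k (revPrefix x n) ((Y k).step 0) + (n + 1) * δ,
        w < s.real 15 0 ∧ s'.real 15 0 = w ∧ Achieves Y n w s' ∨
        s.real 15 0 ≤ w ∧ s'.real 15 0 = s.real 15 0 ∧ s'.idx 1 = s.idx 1 := by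
  have hlast := (Y k).step_zero_nonneg
  -- A state is at most the value of `k` alone plus the upper means of the other variables, each
  -- bounded by its own single value. The zeroed entry keeps `k` from being counted twice.
  have hsum : (Y k).step 0 +
      ∑ t ∈ Finset.range n, Function.update (fun x => (Y x).upperMean) k 0 (x t) ≤ G * δ := by
    have h0 : ∀ y, 0 ≤ Function.update (fun x => (Y x).upperMean) k 0 y := fun y => by
      rw [Function.update_apply]; split_ifs; exacts [le_rfl, (Y y).upperMean_nonneg]
    refine le_trans (add_le_add_right (sum_arrangement_le hx h0) _) (le_trans ?_ hG)
    have h1 : (Y k).step 0 = ∑ y ∈ Finset.range n, if k = y then (Y y).step 0 else 0 := by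
      rw [Finset.sum_ite_eq, if_pos (Finset.mem_range.mpr hk)]
    rw [h1, ← Finset.sum_add_distrib]
    refine Finset.sum_le_sum fun y _ => ?_
    rcases eq_or_ne y k with rfl | hy
    · simp
    · rw [if_neg hy.symm, Function.update_of_ne hy, zero_add]
      exact (Y y).upperMean_le_step_zero
  have hvG : (Y k).step 0 ≤ G * δ := by
    refine le_trans (le_add_of_nonneg_right (Finset.sum_nonneg fun t _ => ?_)) hsum
    rw [Function.update_apply]; split_ifs; exacts [le_rfl, (Y _).upperMean_nonneg]
  refine (Runs.seq (U := G * 50 + 50 + (n * 100 + 70)) (runs_table hs.input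
    (by rw [hs.order]; exact hx.1) hs.last hs.columns hs.grid h7 hδ) ?_).mono
    (by lia) fun _ _ h => h
  rintro s₁ hf₁ ⟨hT, h8⟩
  rw [hs.order] at hT
  refine Runs.seq (runs_start (k := k) (δ := δ) (v := (Y k).step 0)
    (by rw [hf₁.1 6 (by decide), hs.last]) (by rw [hf₁.1 7 (by decide), h7])
    (by rw [hf₁.2 8 (by decide)]; exact hs.grid)
    (by rw [hf₁.2 11 (by decide), hs.single k hk]) hlast hvG hδ) ?_
  rintro s₂ hf₂ ⟨g, hg, h9, hgv, hvg⟩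
  have hT₂ : HasTable Y k n G δ x s₂ := by
    unfold HasTable
    rw [hf₂.1 11 (by decide), hf₂.2 9 (by decide)]
    exact hT
  have h8₂ : s₂.idx 8 0 = n * (G + 1) := by rw [hf₂.1 8 (by decide), h8]
  have h15 : s₂.real 15 0 = s.real 15 0 := by rw [hf₂.2 15 (by decide), hf₁.2 15 (by decide)]
  have hupd : ∀ (f : ℕ → ℝ) (P : ℝ → Prop), P 0 → (∀ x, P (f x)) →
      ∀ x, P (Function.update f k 0 x) := by
    intro f P h0 h x
    rw [Function.update_apply]; split_ifs; exacts [h0, h x]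
  have hcd : ∀ y, Function.update (fun x => (Y x).upperMean) k 0 y ≤
      Function.update (fun x => (Y x).upperProb) k 0 y := fun y => by
    rw [Function.update_apply, Function.update_apply]
    split_ifs
    exacts [le_rfl, (Y y).upperMean_le_upperProb]
  have hw : s₂.real 9 (n * (G + 1) + g) ≤
      lastCost Y k (revPrefix x n) ((Y k).step 0) + (n + 1) * δ := by
    have := hT₂.le_optCost (hupd _ (0 ≤ ·) le_rfl fun x => (Y x).q_nonneg)
      (hupd _ (· ≤ 1) zero_le_one fun x => (Y x).q_le_one) hδ
      (hupd _ (0 ≤ ·) le_rfl fun x => (Y x).upperMean_nonneg) hcd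
      (hupd _ (· ≤ 1) zero_le_one fun x => (Y x).upperProb_le_one) le_rfl hg zero_le_one hlast
      ((Y k).step_le_one zero_le_one) hvg hsum
    rwa [add_comm (1 : ℝ)] at this
  refine (Runs.ite (T := n * 100 + 50) (fun hb => ?_) fun hb => ?_).mono
    (by simp [Test.cost, RealExpr.cost, IdxExpr.cost]; lia) fun _ _ h => h
  · have hb' : s₂.real 9 (n * (G + 1) + g) < s.real 15 0 := by
      simpa only [Test.Holds, RealExpr.eval, IdxExpr.eval, h8₂, h9, h15] using hb
    refine (Runs.seq (T := 10) (U := n * 100 + 40)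
      (Φ := (· = s₂.setReal 15 0 (s₂.real 9 (n * (G + 1) + g))))
      (Runs.flat (by trivial) (by decide) fun _ => ?_) ?_).mono (by lia) fun _ _ h => h
    · simp [Prog.flat, RealExpr.eval, IdxExpr.eval, h8₂, h9]
    rintro s₃ hf₃ rfl
    refine (runs_trace (s := s₂.setReal 15 0 (s₂.real 9 (n * (G + 1) + g))) (Y := Y)
      (k := k) (x := x) (δ := δ) (v := (Y k).step 0) ?_ ?_ ?_ ?_ ?_ h8₂ h9 hg hgv (cons_filter_perm_range hx hk)).mono le_rfl ?_
    · unfold HasTable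
      rw [hf₃.1 11 (by decide), hf₃.2 9 (by decide)]
      exact hT₂
    · rw [hf₃.1 0 (by decide), hf₂.1 0 (by decide), hf₁.1 0 (by decide), hs.input.size]
    · rw [hf₃.1 2 (by decide), hf₂.1 2 (by decide), hf₁.1 2 (by decide), hs.order]
    · rw [hf₃.1 14 (by decide), hf₂.1 14 (by decide), hf₁.1 14 (by decide), hs.columns]
    · rw [hf₃.1 7 (by decide), hf₂.1 7 (by decide), hf₁.1 7 (by decide), h7]
    · rintro s₄ hf₄ ⟨l₁, l₂, hp, ho, hm⟩
      rw [hf₃.2 9 (by decide)] at hm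
      refine ⟨_, hw, Or.inl ⟨hb', ?_, l₁ ++ (l₂ ++ [k]), hp, ho, ?_⟩⟩
      · rw [hf₄.2 15 (by decide)]
        simp
      · exact (sub_le_sub_left hm 1).trans (le_stoppingValue Y k l₁ l₂)
  · have hb' : ¬ s₂.real 9 (n * (G + 1) + g) < s.real 15 0 := by
      simpa only [Test.Holds, RealExpr.eval, IdxExpr.eval, h8₂, h9, h15] using hb
    refine Runs.flat (by trivial) (by simp [Prog.flatCost]) fun _ =>
      ⟨_, hw, Or.inr ⟨not_lt.mp hb', h15, ?_⟩⟩
    rw [Prog.flat, hf₂.1 1 (by decide), hf₁.1 1 (by decide)]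

/-- The complete program. -/
def orderingProg : Prog :=
  .seq setupProg <| .seq sortProg <| .seq gridProg <| .seq (.setReal 15 (.lit 0) (.lit 1)) <|
    forLoop 7 0 candidateProg

lemma runs_ordering {Y : ℕ → ThreePointVar} {n M : ℕ} {ε δ : ℝ} {s : State}
    (hs : HasInput Y n ε s) (h5 : s.real 5 0 = 0) (h6 : s.real 6 0 = 0) (h8 : s.real 8 0 = 0)
    (hi6 : s.idx 6 0 = 0) (hδ0 : 0 ≤ δ)
    (hδ : δ = ε * (∑ y ∈ Finset.range n, (Y y).step 0) / (n * (n + 1)))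
    (hM : ∑ y ∈ Finset.range n, (Y y).step 0 ≤ M * δ) (hn : 1 ≤ n) :
    Runs orderingProg s (n * n * (M + 1) * 1200) fun s' => ∃ (w : ℝ) (l : List ℕ),
      Achieves Y n w s' ∧ l.Perm (List.range n) ∧
      (l.Pairwise fun x y => (Y x).upperMean / (Y x).upperProb ≤
        (Y y).upperMean / (Y y).upperProb) ∧
      ∀ k < n, w ≤ lastCost Y k l ((Y k).step 0) + (n + 1) * δ := by
  refine (Runs.seq (runs_setup hs h5 h6) (U := n * (n * 100 + 30) + 9 + (M * 40 + 40 +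
    (3 + (n * ((M + 1) * 100 + n * ((M + 1) * 252 + 250) + 150 + 12) + 9)))) ?_).mono ?_
    fun _ _ h => h
  swap
  -- The dominant term is `n` tables of `n` rows with at most `M + 1` columns; `1 ≤ n` absorbs the
  -- others.
  · have h1 : n ≤ n * n * (M + 1) := by
      calc n ≤ n * n := Nat.le_mul_of_pos_left n hn
        _ ≤ n * n * (M + 1) := Nat.le_mul_of_pos_right _ (Nat.succ_pos M)
    have h2 : n * n ≤ n * n * (M + 1) := Nat.le_mul_of_pos_right _ (Nat.succ_pos M)
    have h3 : M + 1 ≤ n * n * (M + 1) := Nat.le_mul_of_pos_left _ (Nat.mul_pos hn hn)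
    have h4 : n * (M + 1) ≤ n * n * (M + 1) :=
      Nat.mul_le_mul_right _ (Nat.le_mul_of_pos_left n hn)
    linarith
  rintro s₁ hf₁ ⟨ht, hS, hn₁⟩
  have hs₁ := hs.of_frame hf₁ (by decide) (by decide)
  refine Runs.seq (runs_sort hs₁.size (fun y => sortKey (Y y)) (fun t h => (ht t h).2.2.1)
    ⟨fun t h => ?_, fun t h u h' e => ?_⟩) ?_
  · rw [(ht t h).2.1]; exact h
  · rwa [(ht t h).2.1, (ht u h').2.1] at e
  rintro s₂ hf₂ ⟨hx, hsort⟩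
  have hs₂ := hs₁.of_frame hf₂ (by decide) (by decide)
  refine Runs.seq (runs_grid (n := n) (M := M) (δ := δ) hs₂.accuracy
    (by rw [hf₂.2 5 (by decide), hS]) (by rw [hf₂.2 6 (by decide), hn₁])
    (by rw [hf₂.1 6 (by decide), hf₁.1 6 (by decide), hi6])
    (by rw [hf₂.2 8 (by decide), hf₁.2 8 (by decide), h8]) hδ hM) ?_
  rintro s₃ hf₃ ⟨G, hGM, hG, hG1, hSG, hgrid⟩
  have hs₃ := hs₂.of_frame hf₃ (by decide) (by decide)
  refine Runs.seq (Φ := (· = s₃.setReal 15 0 1))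
    (Runs.flat (by trivial) (by decide) fun _ => ?_) ?_
  · simp [Prog.flat, IdxExpr.eval, RealExpr.eval]
  rintro _ hf₄ rfl
  have hs₄ : IsReady Y n G ε δ (s₂.idx 2) (s₃.setReal 15 0 1) := by
    refine ⟨hs₃.of_frame hf₄ (by decide) (by decide), ?_, hG, hG1, ?_, fun t h => ?_⟩
    · rw [hf₄.1 2 (by decide), hf₃.1 2 (by decide)]
    · rw [hf₄.2 8 (by decide)]; exact hgrid
    · rw [hf₄.2 11 (by decide), hf₃.2 11 (by decide), hf₂.2 11 (by decide), (ht t h).2.2.2]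
  have hout : ∀ t < n, (s₃.setReal 15 0 1).idx 1 t = t := fun t h => by
    rw [hf₄.1 1 (by decide), hf₃.1 1 (by decide), hf₂.1 1 (by decide), (ht t h).1]
  refine (Runs.forLoop (T := (M + 1) * 100 + n * ((M + 1) * 252 + 250) + 150) (fun k s' =>
    Achieves Y n (s'.real 15 0) s' ∧ ∀ j < k, s'.real 15 0 ≤
      lastCost Y j (revPrefix (s₂.idx 2) n) ((Y j).step 0) + (n + 1) * δ) hs₄.input.size
    (by decide) (by decide) ?_ ⟨⟨List.range n, List.Perm.refl _, ?_, ?_⟩, ?_⟩ ?_).mono le_rfl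
    fun s' _ h => ⟨s'.real 15 0, revPrefix (s₂.idx 2) n, h.1, revPrefix_perm_range hx,
      pairwise_revPrefix hsort, h.2⟩
  · intro k s v h
    simpa [Achieves] using h
  · intro i a hi
    have hi' := (List.getElem?_eq_some_iff.mp hi).1
    rw [List.length_range] at hi'
    rw [List.getElem?_range hi', Option.some.injEq] at hi
    rw [hout i hi', hi]
  -- The initial cost 1 only claims that the identity ordering has nonnegative value, so the output
  -- is valid even if no candidate improves on it.
  · simpa using (stoppingValue_nonneg_le_one _).1
  · simp
  · rintro k s₅ hf₅ hk h7 ⟨ha, hb⟩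
    have hs₅ : IsReady Y n G ε δ (s₂.idx 2) s₅ := by
      refine ⟨hs₄.input.of_frame hf₅ (by decide) (by decide), ?_, ?_, ?_, ?_, ?_⟩
      · rw [hf₅.1 2 (by decide), hs₄.order]
      · rw [hf₅.1 6 (by decide), hs₄.last]
      · rw [hf₅.1 14 (by decide), hs₄.columns]
      · rw [hf₅.2 8 (by decide)]; exact hs₄.grid
      · rw [hf₅.2 11 (by decide)]; exact hs₄.single
    refine (runs_candidate hs₅ hx hδ0 hSG hk h7).mono (by gcongr) ?_
    rintro s₆ hf₆ ⟨w, hw, ⟨hlt, h15, hach⟩ | ⟨hle, h15, h1⟩⟩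
    · rw [h15]
      refine ⟨hach, fun j hj => ?_⟩
      rcases (Nat.lt_succ_iff.mp hj).eq_or_lt with rfl | hj
      · exact hw
      · exact hlt.le.trans (hb j hj)
    · rw [h15]
      refine ⟨?_, fun j hj => ?_⟩
      · unfold Achieves
        rw [h1]
        exact ha
      · rcases (Nat.lt_succ_iff.mp hj).eq_or_lt with rfl | hj
        · exact hle.trans hw
        · exact hb j hj

end RealRAM

/-! ### Permutations and the final estimate -/

section Orderings

variable {n : ℕ} (X : Fin n → ThreePointVar)

/-- The variables, indexed by all natural numbers. -/
def extendVars (hn : 1 ≤ n) (i : ℕ) : ThreePointVar :=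
  if h : i < n then X ⟨i, h⟩ else X ⟨0, hn⟩

lemma orderingValue_eq_extend (hn : 1 ≤ n) (σ : Equiv.Perm (Fin n)) :
    orderingValue X σ =
      stoppingValue ((List.ofFn fun t => (σ t : ℕ)).map (extendVars X hn)) := by
  rw [orderingValue_eq, List.map_ofFn]
  congr 2
  funext t
  simp [extendVars]

lemma ofFn_perm_range (σ : Equiv.Perm (Fin n)) :
    (List.ofFn fun t => (σ t : ℕ)).Perm (List.range n) := by
  refine perm_range_of_nodup ?_ (by simp) fun a ha => ?_
  · exact List.nodup_ofFn.mpr (Fin.val_injective.comp σ.injective)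
  · obtain ⟨t, rfl⟩ := (List.mem_ofFn' _ _).mp ha
    exact (σ t).isLt

lemma exists_perm_ofFn_eq {l : List ℕ} (hl : l.Perm (List.range n)) :
    ∃ σ : Equiv.Perm (Fin n), List.ofFn (fun t => (σ t : ℕ)) = l := by
  have hlen : l.length = n := by simpa using hl.length_eq
  have hlt : ∀ t : Fin n, l[(t : ℕ)]'(by lia) < n := fun t =>
    List.mem_range.mp (hl.subset (List.getElem_mem _))
  have hinj : Function.Injective fun t : Fin n => (⟨l[(t : ℕ)]'(by lia), hlt t⟩ : Fin n) := by
    intro t u h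
    have hnd : l.Nodup := hl.nodup_iff.mpr List.nodup_range
    exact Fin.ext ((hnd.getElem_inj_iff).mp (Fin.mk.inj h))
  refine ⟨Equiv.ofBijective _ (Finite.injective_iff_bijective.mp hinj), ?_⟩
  refine List.ext_getElem (by simp [hlen]) fun i h1 h2 => ?_
  simp

/-- The continuation value after `i` is nonnegative, and variables observed earlier never decrease
the value. -/
lemma step_zero_le_stoppingValue {ι : Type*} (Y : ι → ThreePointVar) {l : List ι} {i : ι}
    (hi : i ∈ l) : (Y i).step 0 ≤ stoppingValue (l.map Y) := by
  induction l with
  | nil => simp at hi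
  | cons x l ih =>
    rw [List.map_cons, stoppingValue_cons]
    have hb := stoppingValue_nonneg_le_one (l.map Y)
    rcases List.mem_cons.mp hi with rfl | hi
    · exact (Y i).step_mono hb.1
    · exact (ih hi).trans ((Y x).le_step hb.2)

lemma RealRAM.hasInput_inputState (hn : 1 ≤ n) (ε : ℝ) :
    RealRAM.HasInput (extendVars X hn) n ε (inputState X ε) := by
  constructor <;> simp +contextual [inputState, extendVars]

end Orderings

theorem mainTheorem4 :
    ∃ (P : RealRAM.Prog) (C : ℝ), ∀ (n : ℕ) (X : Fin n → ThreePointVar) (ε : ℝ),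
      1 ≤ n → 0 < ε → ε < 1 →
        ∃ (t : ℕ) (s : RealRAM.State) (σ : Equiv.Perm (Fin n)),
          RealRAM.Exec P (inputState X ε) t s ∧
          (t : ℝ) ≤ C * ((n : ℝ) ^ 5 / ε ^ 2) ∧
          OutputsOrdering s σ ∧
          (1 - ε) * optimalOrderingValue X ≤ orderingValue X σ := by
  refine ⟨RealRAM.orderingProg, 4800, fun n X ε hn hε hε1 => ?_⟩
  set Y := extendVars X hn
  set S := ∑ y ∈ Finset.range n, (Y y).step 0 with hSdef
  have hn' : (1 : ℝ) ≤ n := by exact_mod_cast hn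
  have hS0 : 0 ≤ S := Finset.sum_nonneg fun y _ => (Y y).step_zero_nonneg
  set δ := ε * S / (n * (n + 1)) with hδdef
  have hδ0 : 0 ≤ δ := by positivity
  set M := ⌈(n * (n + 1) / ε : ℝ)⌉₊
  have hM : S ≤ M * δ := by
    refine le_trans (le_of_eq ?_) (mul_le_mul_of_nonneg_right (Nat.le_ceil _) hδ0)
    rw [hδdef]
    field_simp
  obtain ⟨t, s, hexec, ht, w, l, ⟨l', hl', hout, hval⟩, hl, hsort, hw⟩ :=
    RealRAM.runs_ordering (RealRAM.hasInput_inputState X hn ε) (by simp [inputState])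
      (by simp [inputState]) (by simp [inputState]) (by simp [inputState]) hδ0 hδdef hM hn
  obtain ⟨σ, hσ⟩ := exists_perm_ofFn_eq hl'
  refine ⟨t, s, σ, hexec, ?_, fun t => ?_, ?_⟩
  -- Here `n * (n + 1) ≤ 2 * n ^ 2`, and the two units from the ceiling and from `+ 1` are each at
  -- most `n ^ 2 / ε`. With the factor 1200 this gives 4800.
  · have h1 : ((M : ℝ) + 1) ≤ 4 * (n ^ 2 / ε) := by
      have h2 : (M : ℝ) < n * (n + 1) / ε + 1 := Nat.ceil_lt_add_one (by positivity)
      have h3 : (1 : ℝ) ≤ n ^ 2 / ε := by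
        rw [le_div_iff₀ hε]
        nlinarith
      have h4 : (n * (n + 1) / ε : ℝ) ≤ 2 * (n ^ 2 / ε) := by
        rw [← mul_div_assoc]
        refine div_le_div_of_nonneg_right ?_ hε.le
        nlinarith
      linarith
    calc (t : ℝ) ≤ ((n * n * (M + 1) * 1200 : ℕ) : ℝ) := by exact_mod_cast ht
      _ = (n : ℝ) ^ 2 * (M + 1) * 1200 := by push_cast; ring
      _ ≤ (n : ℝ) ^ 2 * (4 * (n ^ 2 / ε)) * 1200 := by gcongr
      _ = 4800 * ((n : ℝ) ^ 4 * 1 / (ε * 1)) := by ring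
      -- Only here is `n ^ 4 / ε` weakened to `n ^ 5 / ε ^ 2`.
      _ ≤ 4800 * ((n : ℝ) ^ 4 * n / (ε * ε)) := by gcongr
      _ = 4800 * ((n : ℝ) ^ 5 / ε ^ 2) := by ring
  · refine hout t _ ?_
    rw [← hσ]
    simp
  · have hub : optimalOrderingValue X ≤ orderingValue X σ + (n + 1) * δ := by
      refine ciSup_le fun ρ => ?_
      rw [orderingValue_eq_extend X hn ρ, orderingValue_eq_extend X hn σ, hσ]
      have hp := ofFn_perm_range ρ
      obtain ⟨k, hk, hle⟩ := exists_stoppingValue_le_lastCost Y _ l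
        (List.ne_nil_of_length_pos (by simp; lia)) (hp.nodup_iff.mpr List.nodup_range) hsort
        (hl.trans hp.symm)
      have := hw k (List.mem_range.mp (hp.subset hk))
      linarith
    -- This makes the additive error relative: no single variable is worth more than the optimum.
    have hlb : S ≤ n * optimalOrderingValue X := by
      have h1 : ∀ y ∈ Finset.range n, (Y y).step 0 ≤ optimalOrderingValue X := fun y hy => by
        refine le_trans ?_ (le_ciSup (Set.finite_range _).bddAbove (1 : Equiv.Perm (Fin n)))
        rw [orderingValue_eq_extend X hn]
        refine step_zero_le_stoppingValue Y ((ofFn_perm_range _).symm.subset ?_)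
        simpa using hy
      simpa using Finset.sum_le_card_nsmul _ _ _ h1
    have herr : (n + 1) * δ ≤ ε * optimalOrderingValue X := by
      have : (n + 1) * δ = ε * (S / n) := by
        rw [hδdef]
        field_simp
      rw [this]
      refine mul_le_mul_of_nonneg_left ?_ hε.le
      rw [div_le_iff₀ (by linarith)]
      linarith
    linarith
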